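/- Let $X$ be a proper ${\rm CAT}(0)$-space with visual boundary $\partial X$. A geodesic $\gamma:\mathbb R\to X$ is called $B$-contracting $(B>0)$ if for every closed metric ball $K\subset X$ disjoint from $\gamma(\mathbb R)$ the shortest distance projection $\pi_{\gamma(\mathbb R)}(K)$ has diameter at most $B$. Let ${\cal A}(B)\subset\partial X\times\partial X-\Delta$ be the set of all pairs $(\gamma(-\infty),\gamma(\infty))$ where $\gamma:\mathbb R\to X$ is a $B$-contracting geodesic. For $x\in X$ and geodesics $\zeta_1,\zeta_2:\mathbb R\to X$ let $[a_i,b_i]=\{t\mid d(\zeta_i(t),\zeta_{i+1}(\mathbb R))\le 6B+2\}$ (indices modulo two; the ends may be infinite), let $\zeta_i(s_i)$, $\zeta_i(t_i)$ be the projections to $\zeta_i$ of $\zeta_{i+1}(a_{i+1})$, $\zeta_{i+1}(b_{i+1})$, and let $x_i=\pi_{\zeta_i(\mathbb R)}(x)$. (The projection to a geodesic of a point of $\partial X$ is defined through the minimum of its Busemann function; it is an end of the geodesic if the Busemann function has no minimum there and approaches its infimum at that end.) If these intervals are not empty and if $s_i<t_i$ and $x_i\in\zeta_i[a_i,b_i]$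 for $i=1,2$, put $\tau_B(x,\zeta_1,\zeta_2)=\min\{d(x_i,\zeta_i(a_i)),d(x_i,\zeta_i(b_i))\mid i=1,2\}$, where the distance to a point at infinity is $\infty$; otherwise put $\tau_B(x,\zeta_1,\zeta_2)=0$. For $\alpha_1\neq\alpha_2$ in ${\cal A}(B)$ let $\tau_B(x,\alpha_1,\alpha_2)$, which is finite, be the infimum of $\tau_B(x,\zeta_1,\zeta_2)$ over all $B$-contracting geodesics $\zeta_i$ connecting the two components of $\alpha_i$. For $\chi>0$ put $\tilde\delta_x(\alpha_1,\alpha_2)=e^{-\chi\tau_B(x,\alpha_1,\alpha_2)}$ if $\alpha_1\ne\alpha_2$ and $\tilde\delta_x(\alpha,\alpha)=0$. There is a universal constant $L>0$ such that the following holds for every $B>0$, every $\chi>0$ with $\chi'=e^{\chi L(B+1)}-1<\sqrt2-1$, and every proper ${\rm CAT}(0)$-space $X$. There is a family $\{\delta_x\}_{x\in X}$ of metrics on ${\cal A}(B)$ such that: 1. for every $x$ the topology on ${\cal A}(B)$ defined by $\delta_x$ is the restriction of the product topology on $\partial X\times\partial X-\Delta$; in particular, $({\cal A}(B),\delta_x)$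 is locally compact; 2. $\delta_x(\iota\alpha,\iota\beta)=\delta_x(\alpha,\beta)$ for the involution $\iota:(\xi,\eta)\to(\eta,\xi)$ of ${\cal A}(B)$; 3. $(1-2\chi')\tilde\delta_x\le\delta_x\le\tilde\delta_x$ for all $x\in X$; 4. $e^{-\chi d(x,y)}\delta_x\le\delta_y\le e^{\chi d(x,y)}\delta_x$ for all $x,y\in X$; 5. $\delta_{gx}(g\alpha,g\beta)=\delta_x(\alpha,\beta)$ for all $g\in{\rm Iso}(X)$, $x\in X$, $\alpha,\beta\in{\cal A}(B)$. -/

import Mathlib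

open Set Filter Topology
open scoped NNReal ENNReal

universe u

/-- A CAT(0) space: a geodesic metric space in which every geodesic triangle is at least as thin as
its Euclidean comparison triangle. The second field compares the distance from a vertex `p` to the
point `m` of a geodesic side `[y, z]` that divides it in the ratio `t : 1 - t`; its right-hand side
is the squared distance of the corresponding points of the comparison triangle. -/
class IsCAT0 (X : Type u) [MetricSpace X] : Prop where
  exists_geodesic : ∀ x y : X, ∃ c : ℝ → X, c 0 = x ∧ c (dist x y) = y ∧
    ∀ s ∈ Icc 0 (dist x y), ∀ t ∈ Icc 0 (dist x y), dist (c s) (c t) = |s - t|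
  comparison : ∀ (p y z m : X) (t : ℝ), t ∈ Icc (0 : ℝ) 1 →
    dist y m = t * dist y z → dist m z = (1 - t) * dist y z →
    dist p m ^ 2 ≤ (1 - t) * dist p y ^ 2 + t * dist p z ^ 2 - t * (1 - t) * dist y z ^ 2

noncomputable section

/-! ### The visual boundary -/

/-- Geodesic rays, with the topology of uniform convergence on compact sets. -/
abbrev GeodRay (X : Type u) [MetricSpace X] : Type u := {r : C(ℝ≥0, X) // Isometry r}

/-- Two rays are asymptotic if they stay at bounded distance from each other. -/
def asymptoticSetoid (X : Type u) [MetricSpace X] : Setoid (GeodRay X) where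
  r r₁ r₂ := ∃ C : ℝ, ∀ t : ℝ≥0, dist (r₁.1 t) (r₂.1 t) ≤ C
  iseqv :=
    { refl := fun r => ⟨0, fun t => by simp⟩
      symm := fun ⟨C, h⟩ => ⟨C, fun t => by rw [dist_comm]; exact h t⟩
      trans := fun ⟨C, h⟩ ⟨C', h'⟩ =>
        ⟨C + C', fun t => (dist_triangle _ _ _).trans (add_le_add (h t) (h' t))⟩ }

/-- The points of the visual boundary `∂X`: asymptoty classes of geodesic rays. -/
def VisualBoundary (X : Type u) [MetricSpace X] : Type u := Quotient (asymptoticSetoid X)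

variable {X : Type u} [MetricSpace X]

/-- The point at infinity of a ray. -/
def GeodRay.endpoint (r : GeodRay X) : VisualBoundary X := Quotient.mk (asymptoticSetoid X) r

/-- The topology of `∂X` obtained from the rays issuing from the point `o` (in a complete CAT(0)
space each point of `∂X` is the endpoint of exactly one such ray). -/
@[reducible] def coneTopology (o : X) : TopologicalSpace (VisualBoundary X) :=
  TopologicalSpace.coinduced
    (fun r : {r : GeodRay X // r.1 0 = o} => GeodRay.endpoint r.1) inferInstance

/-- The action of an isometry of `X` on rays. -/
def GeodRay.map (g : X ≃ᵢ X) (r : GeodRay X) : GeodRay X :=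
  ⟨⟨fun t => g (r.1 t), g.continuous.comp r.1.continuous⟩, g.isometry.comp r.2⟩

/-- The action of an isometry of `X` on `∂X`. -/
def VisualBoundary.map (g : X ≃ᵢ X) : VisualBoundary X → VisualBoundary X :=
  Quotient.map' (s₁ := asymptoticSetoid X) (s₂ := asymptoticSetoid X) (GeodRay.map g) (by
    rintro r₁ r₂ ⟨C, h⟩
    exact ⟨C, fun t => (g.dist_eq _ _).trans_le (h t)⟩)

/-! ### Contracting geodesic lines -/

/-- Biinfinite geodesics, parametrized by arc length (hence oriented). -/
abbrev GeodLine (X : Type u) [MetricSpace X] : Type u := {γ : ℝ → X // Isometry γ}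

/-- `γ(∞)`. -/
def GeodLine.posEnd (γ : GeodLine X) : VisualBoundary X :=
  GeodRay.endpoint ⟨⟨fun t : ℝ≥0 => γ.1 (t : ℝ), γ.2.continuous.comp NNReal.continuous_coe⟩,
    γ.2.comp isometry_subtype_coe⟩

/-- `γ` with the reversed orientation. -/
def GeodLine.reverse (γ : GeodLine X) : GeodLine X :=
  ⟨fun t => γ.1 (-t), γ.2.comp (IsometryEquiv.neg ℝ).isometry⟩

/-- `γ(-∞)`. -/
def GeodLine.negEnd (γ : GeodLine X) : VisualBoundary X := γ.reverse.posEnd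

/-- `g ∘ γ`. -/
def GeodLine.map (g : X ≃ᵢ X) (γ : GeodLine X) : GeodLine X :=
  ⟨fun t => g (γ.1 t), g.isometry.comp γ.2⟩

/-- The points of `C` nearest to `p` (one point `π_C(p)`, if `X` is a complete CAT(0) space and `C`
is nonempty, closed and convex). -/
def nearestPoints (C : Set X) (p : X) : Set X := {q ∈ C | ∀ c ∈ C, dist p q ≤ dist p c}

/-- `γ` is `B`-contracting: the projection to `γ(ℝ)` of a closed metric ball disjoint from `γ(ℝ)`
has diameter at most `B`. -/
def GeodLine.IsContracting (B : ℝ) (γ : GeodLine X) : Prop :=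
  ∀ (p : X) (r : ℝ), Disjoint (Metric.closedBall p r) (range γ.1) →
    Metric.ediam (⋃ y ∈ Metric.closedBall p r, nearestPoints (range γ.1) y) ≤ ENNReal.ofReal B

/-- `γ` is a `B`-contracting geodesic connecting `α.1` to `α.2`. -/
def GeodLine.ContractingJoins (B : ℝ) (γ : GeodLine X)
    (α : VisualBoundary X × VisualBoundary X) : Prop :=
  γ.IsContracting B ∧ γ.negEnd = α.1 ∧ γ.posEnd = α.2

variable (X) in
/-- The space `𝒜(B)` of pairs of points of `∂X` connected by a `B`-contracting geodesic. -/
def ContractingPairs (B : ℝ) : Set (VisualBoundary X × VisualBoundary X) :=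
  {α | ∃ γ : GeodLine X, γ.ContractingJoins B α}

theorem GeodLine.reverse_reverse (γ : GeodLine X) : γ.reverse.reverse = γ :=
  Subtype.ext (funext fun t => congrArg γ.1 (neg_neg t))

theorem GeodLine.range_reverse (γ : GeodLine X) : range γ.reverse.1 = range γ.1 :=
  (Equiv.neg ℝ).surjective.range_comp γ.1

theorem GeodLine.ContractingJoins.reverse {B : ℝ} {γ : GeodLine X}
    {α : VisualBoundary X × VisualBoundary X} (h : γ.ContractingJoins B α) :
    γ.reverse.ContractingJoins B α.swap := by
  refine ⟨?_, ?_, h.2.1⟩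
  · intro p r hr
    rw [γ.range_reverse] at hr ⊢
    exact h.1 p r hr
  · rw [GeodLine.negEnd, γ.reverse_reverse]
    exact h.2.2

theorem GeodLine.ContractingJoins.map {B : ℝ} {γ : GeodLine X}
    {α : VisualBoundary X × VisualBoundary X} (h : γ.ContractingJoins B α) (g : X ≃ᵢ X) :
    (γ.map g).ContractingJoins B (VisualBoundary.map g α.1, VisualBoundary.map g α.2) := by
  have hrange : range (γ.map g).1 = g '' range γ.1 := range_comp g γ.1
  refine ⟨?_, ?_, ?_⟩
  · intro p r hr
    have hd : Disjoint (Metric.closedBall (g.symm p) r) (range γ.1) := by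
      rw [Set.disjoint_left] at hr ⊢
      intro y hy hyγ
      refine hr (a := g y) ?_ (by rw [hrange]; exact mem_image_of_mem g hyγ)
      rw [Metric.mem_closedBall] at hy ⊢
      rw [← g.symm.dist_eq]
      simpa using hy
    have hsub : (⋃ y ∈ Metric.closedBall p r, nearestPoints (range (γ.map g).1) y) ⊆
        g '' (⋃ y ∈ Metric.closedBall (g.symm p) r, nearestPoints (range γ.1) y) := by
      intro q hq
      simp only [mem_iUnion] at hq
      obtain ⟨y, hy, hq, hmin⟩ := hq
      rw [hrange] at hq hmin
      obtain ⟨q', hq', rfl⟩ := hq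
      refine mem_image_of_mem g ?_
      simp only [mem_iUnion]
      refine ⟨g.symm y, ?_, hq', fun c hc => ?_⟩
      · rw [Metric.mem_closedBall, g.symm.dist_eq]
        exact hy
      · have := hmin (g c) (mem_image_of_mem g hc)
        rw [← g.symm.dist_eq, ← g.symm.dist_eq y] at this
        simpa using this
    refine (Metric.ediam_mono hsub).trans ?_
    rw [g.isometry.ediam_image]
    exact h.1 _ _ hd
  · rw [← h.2.1]
    rfl
  · rw [← h.2.2]
    rfl

/-- The flip `ι : (ξ, η) ↦ (η, ξ)` of `𝒜(B)`. -/
def ContractingPairs.flip {B : ℝ} (α : ContractingPairs X B) : ContractingPairs X B :=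
  ⟨α.1.swap, let ⟨γ, h⟩ := α.2; ⟨γ.reverse, h.reverse⟩⟩

/-- The action of an isometry of `X` on `𝒜(B)`. -/
def ContractingPairs.map {B : ℝ} (g : X ≃ᵢ X) (α : ContractingPairs X B) : ContractingPairs X B :=
  ⟨(VisualBoundary.map g α.1.1, VisualBoundary.map g α.1.2),
    let ⟨γ, h⟩ := α.2; ⟨γ.map g, h.map g⟩⟩

/-! ### The function `τ_B` -/

/-- The parameter `t` such that `γ t` is the projection of `p` to `γ(ℝ)`. -/
def GeodLine.projParam (γ : GeodLine X) (p : X) : ℝ :=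
  Classical.epsilon fun t : ℝ => γ.1 t ∈ nearestPoints (range γ.1) p

/-- The interval `[a, b]` of the parameters at which `ζ` is within `6B + 2` of `ζ'(ℝ)`. -/
def fellowSet (B : ℝ) (ζ ζ' : GeodLine X) : Set ℝ :=
  {t | Metric.infDist (ζ.1 t) (range ζ'.1) ≤ 6 * B + 2}

/-- The left end `a` of the interval, possibly `-∞`. -/
def fellowLeft (B : ℝ) (ζ ζ' : GeodLine X) : EReal :=
  sInf ((fun t : ℝ => (t : EReal)) '' fellowSet B ζ ζ')

/-- The right end `b` of the interval, possibly `∞`. -/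
def fellowRight (B : ℝ) (ζ ζ' : GeodLine X) : EReal :=
  sSup ((fun t : ℝ => (t : EReal)) '' fellowSet B ζ ζ')

open Classical in
/-- The function of `z` whose minimum on a geodesic determines the projection of the point `ζ(e)` of
`X ∪ ∂X`: the distance from `ζ(e)` if `e` is finite, and the Busemann function at `ζ(e)`,
normalized at `ζ(0)`, if `e = ±∞`. -/
def distOrBusemann (ζ : GeodLine X) (e : EReal) (z : X) : ℝ :=
  if e = ⊤ then limUnder atTop fun u : ℝ => dist (ζ.1 u) z - dist (ζ.1 u) (ζ.1 0)
  else if e = ⊥ then limUnder atBot fun u : ℝ => dist (ζ.1 u) z - dist (ζ.1 u) (ζ.1 0)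
  else dist (ζ.1 e.toReal) z

/-- `s` is a point of `[-∞, ∞]` where `f` is minimal; `s = ±∞` means that `f` does not attain its
infimum and approaches it at `±∞`. -/
def IsMinParam (f : ℝ → ℝ) (s : EReal) : Prop :=
  (∃ t : ℝ, s = (t : EReal) ∧ ∀ u, f t ≤ f u) ∨
  (s = ⊤ ∧ ∀ t, ∀ᶠ u in atTop, f u < f t) ∨
  (s = ⊥ ∧ ∀ t, ∀ᶠ u in atBot, f u < f t)

/-- The projection of the point `ζ'(e)` of `X ∪ ∂X` to the geodesic `ζ` is `ζ(s)`. -/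
def ProjectsTo (ζ ζ' : GeodLine X) (e s : EReal) : Prop :=
  IsMinParam (fun t => distOrBusemann ζ' e (ζ.1 t)) s

/-- The projections to `ζ` of the initial and the terminal point of the subarc `[a', b']` of `ζ'`
are `ζ(s)` and `ζ(t)` with `s < t`. -/
def CoherentlyOriented (B : ℝ) (ζ ζ' : GeodLine X) : Prop :=
  ∃ s t : EReal, ProjectsTo ζ ζ' (fellowLeft B ζ' ζ) s ∧ ProjectsTo ζ ζ' (fellowRight B ζ' ζ) t ∧
    s < t

open Classical in
/-- The distance from `p` to `ζ(e)`, infinite if `e = ±∞`. -/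
def distToParam (ζ : GeodLine X) (p : X) (e : EReal) : ℝ≥0∞ :=
  if e = ⊤ ∨ e = ⊥ then ⊤ else ENNReal.ofReal (dist p (ζ.1 e.toReal))

/-- `min {d(π_ζ(x), ζ(a)), d(π_ζ(x), ζ(b))}`. -/
def endDist (B : ℝ) (x : X) (ζ ζ' : GeodLine X) : ℝ≥0∞ :=
  min (distToParam ζ (ζ.1 (ζ.projParam x)) (fellowLeft B ζ ζ'))
    (distToParam ζ (ζ.1 (ζ.projParam x)) (fellowRight B ζ ζ'))

open Classical in
/-- `τ_B(x, ζ₁, ζ₂)` for oriented geodesic lines. The value is finite unless the two lines have the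
same endpoints `ζ₁(-∞) = ζ₂(-∞)` and `ζ₁(∞) = ζ₂(∞)`. -/
def tauLine (B : ℝ) (x : X) (ζ₁ ζ₂ : GeodLine X) : ℝ≥0∞ :=
  if (fellowSet B ζ₁ ζ₂).Nonempty ∧ (fellowSet B ζ₂ ζ₁).Nonempty ∧
      CoherentlyOriented B ζ₁ ζ₂ ∧ CoherentlyOriented B ζ₂ ζ₁ ∧
      ζ₁.projParam x ∈ fellowSet B ζ₁ ζ₂ ∧ ζ₂.projParam x ∈ fellowSet B ζ₂ ζ₁
  then min (endDist B x ζ₁ ζ₂) (endDist B x ζ₂ ζ₁)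
  else 0

/-- `τ_B(x, α₁, α₂)`: the infimum of `τ_B(x, ζ₁, ζ₂)` over all `B`-contracting geodesics `ζᵢ`
connecting the two components of `αᵢ`. -/
def tau (B : ℝ) (x : X) (α₁ α₂ : VisualBoundary X × VisualBoundary X) : ℝ≥0∞ :=
  ⨅ (ζ₁ : GeodLine X) (_ : ζ₁.ContractingJoins B α₁)
    (ζ₂ : GeodLine X) (_ : ζ₂.ContractingJoins B α₂), tauLine B x ζ₁ ζ₂

open Classical in
/-- `δ̃_x(α₁, α₂) = exp (-χ τ_B(x, α₁, α₂))` for `α₁ ≠ α₂`, and `δ̃_x(α, α) = 0`. -/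
def deltaTilde (B χ : ℝ) (x : X) (α₁ α₂ : ContractingPairs X B) : ℝ :=
  if α₁ = α₂ then 0 else Real.exp (-χ * (tau B x α₁.1 α₂.1).toReal)

end

/-!
Up to an additive error proportional to `B + 1`, the number `τ_B(x, α, β)` is the length `T` for
which lines representing `α` and `β` stay uniformly close on the parameters at distance at most `T`
from the projections of `x`. Indeed the projection to a contracting line moves only a bounded amount
along a geodesic that stays far from the line. A geodesic which is close to the line at two points
is therefore close to it between them, and away from these two points the bound is linear in `B` and
independent of the closeness at the two points. Fellow travelling in this sense is transitive, hence
`τ_B(x, α, η) ≥ min (τ_B(x, α, β), τ_B(x, β, η)) - L (B + 1)`, and `δ̃_x` is a quasi-ultrametric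
with constant `exp (χ L (B + 1)) = 1 + χ'`. As `(1 + χ') ^ 2 ≤ 2`, the largest pseudometric `δ_x`
below `δ̃_x` is at least `(1 - 2 χ') δ̃_x`; being canonical, it inherits every symmetry of `δ̃_x`.

The number `τ_B(x, α, β)` is large if and only if the endpoints of `α` and `β` are close in the cone
topology. Limits of contracting lines are contracting, so the sets of all `β` for which
`τ_B(x, α, β)` exceeds a large constant are relatively compact.
-/

section

variable {X : Type u} [MetricSpace X]

/-! ### Convexity of the metric -/

/-- The point `m` divides a geodesic segment from `a` to `b` in the ratio `t : 1 - t`. It is stated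
through distances only, as in the comparison inequality of `IsCAT0`. -/
def DividesSegment (t : ℝ) (a b m : X) : Prop :=
  dist a m = t * dist a b ∧ dist m b = (1 - t) * dist a b

/-- The curve `c` is a geodesic parametrized by arc length on the set `S` of parameters; it is
arbitrary outside of `S`, so that segments, rays and lines are covered at the same time. -/
def IsGeodesicOn (c : ℝ → X) (S : Set ℝ) : Prop :=
  ∀ s ∈ S, ∀ t ∈ S, dist (c s) (c t) = |s - t|

theorem DividesSegment.symm {t : ℝ} {a b m : X} (h : DividesSegment t a b m) :
    DividesSegment (1 - t) b a m := by
  rw [DividesSegment, sub_sub_cancel, dist_comm b m, dist_comm m a, dist_comm b a]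
  exact And.symm h

theorem IsGeodesicOn.mono {c : ℝ → X} {S S' : Set ℝ} (h : IsGeodesicOn c S) (hS : S' ⊆ S) :
    IsGeodesicOn c S' :=
  fun s hs t ht => h s (hS hs) t (hS ht)

theorem IsGeodesicOn.continuousOn {c : ℝ → X} {S : Set ℝ} (h : IsGeodesicOn c S) :
    ContinuousOn c S :=
  LipschitzOnWith.continuousOn (K := 1) <| .of_dist_le_mul fun s hs t ht => by
    rw [h s hs t ht, Real.dist_eq, NNReal.coe_one, one_mul]

theorem IsGeodesicOn.dividesSegment {c : ℝ → X} {S : Set ℝ} (h : IsGeodesicOn c S)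
    (hS : Convex ℝ S) {u v : ℝ} (hu : u ∈ S) (hv : v ∈ S) {t : ℝ} (ht : t ∈ Icc (0 : ℝ) 1) :
    DividesSegment t (c u) (c v) (c ((1 - t) * u + t * v)) := by
  have ht' : 0 ≤ 1 - t := sub_nonneg.2 ht.2
  have hm : (1 - t) * u + t * v ∈ S := hS hu hv ht' ht.1 (by ring)
  constructor
  · rw [h u hu _ hm, h u hu v hv, show u - ((1 - t) * u + t * v) = t * (u - v) by ring, abs_mul,
      abs_of_nonneg ht.1]
  · rw [h _ hm v hv, h u hu v hv, show (1 - t) * u + t * v - v = (1 - t) * (u - v) by ring,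
      abs_mul, abs_of_nonneg ht']

theorem GeodLine.dist_eq (γ : GeodLine X) (s t : ℝ) : dist (γ.1 s) (γ.1 t) = |s - t| := by
  rw [γ.2.dist_eq, Real.dist_eq]

theorem GeodLine.isGeodesicOn (γ : GeodLine X) (S : Set ℝ) : IsGeodesicOn γ.1 S :=
  fun s _ t _ => γ.dist_eq s t

theorem GeodLine.isGeodesicOn_const_add (γ : GeodLine X) (p : ℝ) (S : Set ℝ) :
    IsGeodesicOn (fun t => γ.1 (p + t)) S :=
  fun s _ t _ => by rw [γ.dist_eq, add_sub_add_left_eq_sub]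

theorem GeodLine.dividesSegment (γ : GeodLine X) (u v : ℝ) {t : ℝ} (ht : t ∈ Icc (0 : ℝ) 1) :
    DividesSegment t (γ.1 u) (γ.1 v) (γ.1 ((1 - t) * u + t * v)) :=
  (γ.isGeodesicOn univ).dividesSegment convex_univ (mem_univ u) (mem_univ v) ht

section CAT0

variable [IsCAT0 X]

theorem exists_dividesSegment (a b : X) {t : ℝ} (ht : t ∈ Icc (0 : ℝ) 1) :
    ∃ m, DividesSegment t a b m := by
  obtain ⟨c, rfl, hb, hc⟩ := IsCAT0.exists_geodesic a b
  have h := IsGeodesicOn.dividesSegment hc (convex_Icc _ _) (left_mem_Icc.2 dist_nonneg)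
    (right_mem_Icc.2 dist_nonneg) ht
  rw [hb] at h
  exact ⟨_, h⟩

theorem DividesSegment.sq_dist_le {t : ℝ} (ht : t ∈ Icc (0 : ℝ) 1) {a b m : X}
    (h : DividesSegment t a b m) (p : X) :
    dist p m ^ 2 ≤ (1 - t) * dist p a ^ 2 + t * dist p b ^ 2 - t * (1 - t) * dist a b ^ 2 :=
  IsCAT0.comparison p a b m t ht h.1 h.2

theorem DividesSegment.dist_le_mul_dist {t : ℝ} (ht : t ∈ Icc (0 : ℝ) 1) {a b b' m m' : X}
    (h : DividesSegment t a b m) (h' : DividesSegment t a b' m') :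
    dist m m' ≤ t * dist b b' := by
  have hm := h'.sq_dist_le ht m
  have hb := mul_le_mul_of_nonneg_left (h.sq_dist_le ht b') ht.1
  rw [dist_comm m a, h.1] at hm
  rw [dist_comm b' m, dist_comm b' a, dist_comm b' b] at hb
  exact le_of_sq_le_sq (by linear_combination hm + hb) (mul_nonneg ht.1 dist_nonneg)

theorem DividesSegment.dist_le {t : ℝ} (ht : t ∈ Icc (0 : ℝ) 1) {a b a' b' m m' : X}
    (h : DividesSegment t a b m) (h' : DividesSegment t a' b' m') :
    dist m m' ≤ (1 - t) * dist a a' + t * dist b b' := by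
  obtain ⟨n, hn⟩ := exists_dividesSegment a b' ht
  have hmn := h.dist_le_mul_dist ht hn
  have hnm' := hn.symm.dist_le_mul_dist (Icc.mem_iff_one_sub_mem.1 ht) h'.symm
  linarith [dist_triangle m n m']

theorem IsGeodesicOn.convexOn_dist {c c' : ℝ → X} {S : Set ℝ} (hS : Convex ℝ S)
    (hc : IsGeodesicOn c S) (hc' : IsGeodesicOn c' S) :
    ConvexOn ℝ S fun t => dist (c t) (c' t) := by
  refine ⟨hS, fun u hu v hv a b ha hb hab => ?_⟩
  obtain rfl : a = 1 - b := eq_sub_of_add_eq hab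
  have hb' : b ∈ Icc (0 : ℝ) 1 := ⟨hb, sub_nonneg.1 ha⟩
  exact (hc.dividesSegment hS hu hv hb').dist_le hb' (hc'.dividesSegment hS hu hv hb')

theorem sq_dist_diagonals_le_sq_dist_sides (a b c d : X) :
    dist a c ^ 2 + dist b d ^ 2 ≤ dist a b ^ 2 + dist b c ^ 2 + dist c d ^ 2 + dist d a ^ 2 := by
  have ht : (1 / 2 : ℝ) ∈ Icc (0 : ℝ) 1 := by constructor <;> norm_num
  obtain ⟨m, hm⟩ := exists_dividesSegment a c ht
  have hb := hm.sq_dist_le ht b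
  have hd := hm.sq_dist_le ht d
  have hbd : dist b d ^ 2 ≤ (dist b m + dist d m) ^ 2 :=
    pow_le_pow_left₀ dist_nonneg (dist_triangle_right b d m) 2
  rw [dist_comm b a] at hb
  rw [dist_comm d c] at hd
  nlinarith [sq_nonneg (dist b m - dist d m)]

end CAT0

/-! ### Projection to a geodesic line -/

theorem GeodLine.exists_mem_nearestPoints (γ : GeodLine X) (p : X) :
    ∃ t, γ.1 t ∈ nearestPoints (range γ.1) p := by
  have hlim : Tendsto (fun t => dist p (γ.1 t)) (cocompact ℝ) atTop := by
    refine tendsto_atTop_mono (fun t => ?_)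
      (tendsto_atTop_add_const_right _ (-dist p (γ.1 0)) (tendsto_norm_cocompact_atTop (E := ℝ)))
    have := dist_triangle_left (γ.1 t) (γ.1 0) p
    rw [γ.dist_eq, sub_zero] at this
    rw [Real.norm_eq_abs]
    linarith
  obtain ⟨t, ht⟩ := (continuous_const.dist γ.2.continuous).exists_forall_le hlim
  exact ⟨t, mem_range_self t, forall_mem_range.2 ht⟩

theorem GeodLine.projParam_mem_nearestPoints (γ : GeodLine X) (p : X) :
    γ.1 (γ.projParam p) ∈ nearestPoints (range γ.1) p :=
  Classical.epsilon_spec (γ.exists_mem_nearestPoints p)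

theorem GeodLine.dist_projParam_le (γ : GeodLine X) (p : X) (t : ℝ) :
    dist p (γ.1 (γ.projParam p)) ≤ dist p (γ.1 t) :=
  (γ.projParam_mem_nearestPoints p).2 _ (mem_range_self t)

theorem GeodLine.infDist_range_le (γ : GeodLine X) (p : X) (t : ℝ) :
    Metric.infDist p (range γ.1) ≤ dist p (γ.1 t) :=
  Metric.infDist_le_dist_of_mem (mem_range_self t)

theorem GeodLine.infDist_range_eq (γ : GeodLine X) (p : X) :
    Metric.infDist p (range γ.1) = dist p (γ.1 (γ.projParam p)) :=
  le_antisymm (γ.infDist_range_le p _) <|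
    (Metric.le_infDist (range_nonempty _)).2 (forall_mem_range.2 (γ.dist_projParam_le p))

theorem GeodLine.dist_le_infDist_add_abs_projParam_sub (γ : GeodLine X) (p q : X) :
    dist p q ≤ Metric.infDist p (range γ.1) + |γ.projParam p - γ.projParam q| +
      Metric.infDist q (range γ.1) := by
  rw [γ.infDist_range_eq, γ.infDist_range_eq, ← γ.dist_eq, dist_comm q]
  exact dist_triangle4 _ _ _ _

theorem GeodLine.IsContracting.abs_projParam_sub_le_of_lt_infDist {B : ℝ} (hB : 0 ≤ B)
    {γ : GeodLine X} (h : γ.IsContracting B) {p y z : X} {r : ℝ}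
    (hr : r < Metric.infDist p (range γ.1)) (hy : dist y p ≤ r) (hz : dist z p ≤ r) :
    |γ.projParam y - γ.projParam z| ≤ B := by
  have hdisj : Disjoint (Metric.closedBall p r) (range γ.1) :=
    (Metric.disjoint_ball_infDist (s := range γ.1)).mono_left (Metric.closedBall_subset_ball hr)
  have hmem : ∀ z ∈ Metric.closedBall p r, γ.1 (γ.projParam z) ∈
      ⋃ y ∈ Metric.closedBall p r, nearestPoints (range γ.1) y :=
    fun z hz => mem_biUnion hz (γ.projParam_mem_nearestPoints z)
  have hle := (Metric.edist_le_ediam_of_mem (hmem y hy) (hmem z hz)).trans (h p r hdisj)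
  rwa [edist_dist, ENNReal.ofReal_le_ofReal_iff hB, γ.dist_eq] at hle

section CAT0

variable [IsCAT0 X]

-- The comparison inequality along the segment from `γ t` to `γ u` compares `p` with points
-- arbitrarily close to `γ t`; it gives the bound in the limit.
theorem GeodLine.sq_dist_add_sq_le (γ : GeodLine X) {p : X} {t : ℝ}
    (h : ∀ u, dist p (γ.1 t) ≤ dist p (γ.1 u)) (u : ℝ) :
    dist p (γ.1 t) ^ 2 + (t - u) ^ 2 ≤ dist p (γ.1 u) ^ 2 := by
  have hle : ∀ s ∈ Ioc (0 : ℝ) 1,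
      dist p (γ.1 t) ^ 2 + (1 - s) * (t - u) ^ 2 ≤ dist p (γ.1 u) ^ 2 := by
    intro s hs
    have hs' : s ∈ Icc (0 : ℝ) 1 := Ioc_subset_Icc_self hs
    have hcomp := (γ.dividesSegment t u hs').sq_dist_le hs' p
    have hmin := pow_le_pow_left₀ dist_nonneg (h ((1 - s) * t + s * u)) 2
    rw [γ.dist_eq, sq_abs] at hcomp
    exact le_of_mul_le_mul_left (by linarith) hs.1
  have hlim : Tendsto (fun s => dist p (γ.1 t) ^ 2 + (1 - s) * (t - u) ^ 2) (𝓝[>] 0)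
      (𝓝 (dist p (γ.1 t) ^ 2 + (1 - 0) * (t - u) ^ 2)) :=
    (Continuous.tendsto (by fun_prop) 0).mono_left nhdsWithin_le_nhds
  rw [sub_zero, one_mul] at hlim
  exact le_of_tendsto hlim (eventually_of_mem (Ioc_mem_nhdsGT one_pos) hle)

theorem GeodLine.sq_dist_projParam_add_sq_le (γ : GeodLine X) (p : X) (u : ℝ) :
    dist p (γ.1 (γ.projParam p)) ^ 2 + (γ.projParam p - u) ^ 2 ≤ dist p (γ.1 u) ^ 2 :=
  γ.sq_dist_add_sq_le (γ.dist_projParam_le p) u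

theorem GeodLine.projParam_eq_of_forall_dist_le (γ : GeodLine X) {p : X} {t : ℝ}
    (h : ∀ u, dist p (γ.1 t) ≤ dist p (γ.1 u)) : γ.projParam p = t := by
  have hsq := γ.sq_dist_add_sq_le h (γ.projParam p)
  have hle := pow_le_pow_left₀ dist_nonneg (γ.dist_projParam_le p t) 2
  have hzero : (t - γ.projParam p) ^ 2 = 0 := le_antisymm (by linarith) (sq_nonneg _)
  exact (sub_eq_zero.1 (pow_eq_zero_iff two_ne_zero |>.1 hzero)).symm

theorem GeodLine.projParam_apply (γ : GeodLine X) (t : ℝ) : γ.projParam (γ.1 t) = t :=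
  γ.projParam_eq_of_forall_dist_le fun u => by
    rw [dist_self]
    exact dist_nonneg

theorem GeodLine.abs_projParam_sub_projParam_le (γ : GeodLine X) (p q : X) :
    |γ.projParam p - γ.projParam q| ≤ dist p q := by
  have hp := γ.sq_dist_projParam_add_sq_le p (γ.projParam q)
  have hq := γ.sq_dist_projParam_add_sq_le q (γ.projParam p)
  have hquad := sq_dist_diagonals_le_sq_dist_sides p (γ.1 (γ.projParam p)) (γ.1 (γ.projParam q)) q
  rw [γ.dist_eq, sq_abs, dist_comm _ q, dist_comm (γ.1 _) q, dist_comm q p] at hquad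
  exact abs_le_of_sq_le_sq (by linarith) dist_nonneg

theorem GeodLine.continuous_projParam (γ : GeodLine X) : Continuous γ.projParam :=
  LipschitzWith.continuous (K := 1) <| .of_dist_le_mul fun p q => by
    rw [Real.dist_eq, NNReal.coe_one, one_mul]
    exact γ.abs_projParam_sub_projParam_le p q

theorem IsGeodesicOn.convexOn_infDist_range {c : ℝ → X} {S : Set ℝ} (hS : Convex ℝ S)
    (hc : IsGeodesicOn c S) (γ : GeodLine X) :
    ConvexOn ℝ S fun t => Metric.infDist (c t) (range γ.1) := by
  refine ⟨hS, fun u hu v hv a b ha hb hab => ?_⟩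
  obtain rfl : a = 1 - b := eq_sub_of_add_eq hab
  have hb' : b ∈ Icc (0 : ℝ) 1 := ⟨hb, sub_nonneg.1 ha⟩
  have hdist := (hc.dividesSegment hS hu hv hb').dist_le hb'
    (γ.dividesSegment (γ.projParam (c u)) (γ.projParam (c v)) hb')
  rw [← γ.infDist_range_eq, ← γ.infDist_range_eq] at hdist
  exact (γ.infDist_range_le _ _).trans hdist

end CAT0

end

section

/-! ### Geodesics and contracting lines -/

theorem dist_le_mul_of_forall_dist_le {E : Type*} [PseudoMetricSpace E] {f : ℝ → E} {a b B D : ℝ}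
    (hab : a ≤ b) (hD : 0 < D)
    (hf : ∀ s ∈ Icc a b, ∀ t ∈ Icc a b, |s - t| ≤ D → dist (f s) (f t) ≤ B) :
    dist (f a) (f b) ≤ B * ((b - a) / D + 1) := by
  have ha : a ∈ Icc a b := left_mem_Icc.2 hab
  have hB : 0 ≤ B := dist_nonneg.trans (hf a ha a ha (by simpa using hD.le))
  set n := ⌈(b - a) / D⌉₊
  have hn : b ≤ a + n * D := by
    linarith [(div_le_iff₀ hD).1 (Nat.le_ceil ((b - a) / D))]
  have hmem (k : ℕ) : min (a + k * D) b ∈ Icc a b :=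
    ⟨le_min (le_add_of_nonneg_right (by positivity)) hab, min_le_right _ _⟩
  have hstep (k : ℕ) :
      dist (f (min (a + k * D) b)) (f (min (a + (k + 1 : ℕ) * D) b)) ≤ B := by
    refine hf _ (hmem k) _ (hmem (k + 1)) ((abs_min_sub_min_le_max _ _ _ _).trans ?_)
    rw [sub_self, abs_zero, Nat.cast_succ, add_one_mul, ← add_assoc, sub_add_cancel_left, abs_neg,
      abs_of_pos hD]
    exact max_le le_rfl hD.le
  have hsum := dist_le_range_sum_of_dist_le (f := fun k : ℕ => f (min (a + k * D) b)) n
    (d := fun _ => B) fun {k} _ => hstep k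
  rw [Nat.cast_zero, zero_mul, add_zero, min_eq_left hab, min_eq_right hn, Finset.sum_const,
    Finset.card_range, nsmul_eq_mul, mul_comm] at hsum
  have hceil := (Nat.ceil_lt_add_one (div_nonneg (sub_nonneg.2 hab) hD.le)).le
  exact hsum.trans (mul_le_mul_of_nonneg_left hceil hB)

variable {X : Type u} [MetricSpace X]

theorem IsGeodesicOn.comp_neg {c : ℝ → X} {S : Set ℝ} (h : IsGeodesicOn c S) :
    IsGeodesicOn (fun t => c (-t)) (Neg.neg ⁻¹' S) := fun s hs t ht => by
  rw [h _ hs _ ht, neg_sub_neg, abs_sub_comm]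

variable {B : ℝ} {γ : GeodLine X} {c : ℝ → X} {a b : ℝ}

theorem IsGeodesicOn.sub_le_infDist_add_abs_projParam_sub (hc : IsGeodesicOn c (Icc a b))
    (hab : a ≤ b) (γ : GeodLine X) :
    b - a ≤ Metric.infDist (c a) (range γ.1) + |γ.projParam (c a) - γ.projParam (c b)| +
      Metric.infDist (c b) (range γ.1) := by
  have hdist := hc a (left_mem_Icc.2 hab) b (right_mem_Icc.2 hab)
  rw [abs_sub_comm, abs_of_nonneg (sub_nonneg.2 hab)] at hdist
  exact hdist ▸ γ.dist_le_infDist_add_abs_projParam_sub (c a) (c b)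

theorem GeodLine.IsContracting.abs_projParam_sub_le_mul (hB : 0 ≤ B) (h : γ.IsContracting B)
    {D : ℝ} (hD : 0 < D) (hab : a ≤ b) (hc : IsGeodesicOn c (Icc a b))
    (hfar : ∀ t ∈ Icc a b, D < Metric.infDist (c t) (range γ.1)) :
    |γ.projParam (c a) - γ.projParam (c b)| ≤ B * ((b - a) / D + 1) :=
  dist_le_mul_of_forall_dist_le (f := fun t => γ.projParam (c t)) hab hD fun s hs t ht hst =>
    h.abs_projParam_sub_le_of_lt_infDist hB (hfar t ht) ((hc s hs t ht).trans_le hst)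
      ((dist_self (c t)).trans_le hD.le)

-- The balls of radius `d(·, γ) - D` at the two ends of the arc contribute at most `2B`, and the
-- remaining arc is at most `2D` longer than the projection.
theorem GeodLine.IsContracting.abs_projParam_sub_le_add_div (hB : 0 ≤ B) (h : γ.IsContracting B)
    {D : ℝ} (hD : 0 < D) (hab : a ≤ b) (hc : IsGeodesicOn c (Icc a b))
    (hfar : ∀ t ∈ Icc a b, D < Metric.infDist (c t) (range γ.1)) :
    |γ.projParam (c a) - γ.projParam (c b)| ≤
      5 * B + B * |γ.projParam (c a) - γ.projParam (c b)| / D := by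
  have ha := left_mem_Icc.2 hab
  have hb := right_mem_Icc.2 hab
  set ra := Metric.infDist (c a) (range γ.1) - D
  set rb := Metric.infDist (c b) (range γ.1) - D
  have hra : 0 < ra := sub_pos.2 (hfar a ha)
  have hrb : 0 < rb := sub_pos.2 (hfar b hb)
  obtain ⟨a', ha', haa', hba'⟩ : ∃ a' ∈ Icc a b, a' - a ≤ ra ∧ (a' = b ∨ a' - a = ra) := by
    rcases le_total (b - a) ra with hle | hle
    · exact ⟨b, hb, hle, .inl rfl⟩
    · exact ⟨a + ra, ⟨by linarith, by linarith⟩, by linarith, .inr (by ring)⟩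
  obtain ⟨b', hb', hbb', hab'⟩ : ∃ b' ∈ Icc a' b, b - b' ≤ rb ∧ (b' = a' ∨ b - b' = rb) := by
    rcases le_total (b - a') rb with hle | hle
    · exact ⟨a', left_mem_Icc.2 ha'.2, hle, .inl rfl⟩
    · exact ⟨b - rb, ⟨by linarith, by linarith⟩, by linarith, .inr (by ring)⟩
  have hsub : Icc a' b' ⊆ Icc a b := Icc_subset_Icc ha'.1 hb'.2
  have hstart := h.abs_projParam_sub_le_of_lt_infDist hB (p := c a) (y := c a) (z := c a')
    (sub_lt_self _ hD) ((dist_self _).trans_le hra.le) (by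
      rwa [hc _ ha' _ ha, abs_of_nonneg (sub_nonneg.2 ha'.1)])
  have hend := h.abs_projParam_sub_le_of_lt_infDist hB (p := c b) (y := c b') (z := c b)
    (sub_lt_self _ hD) (by
      rwa [hc _ (hsub (right_mem_Icc.2 hb'.1)) _ hb, abs_sub_comm,
        abs_of_nonneg (sub_nonneg.2 hb'.2)]) ((dist_self _).trans_le hrb.le)
  have hmiddle := h.abs_projParam_sub_le_mul hB hD hb'.1 (hc.mono hsub) fun t ht =>
    hfar t (hsub ht)
  set w := |γ.projParam (c a) - γ.projParam (c b)|
  have hw : w ≤ B + B * ((b' - a') / D + 1) + B := by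
    linarith [abs_sub_le (γ.projParam (c a)) (γ.projParam (c a')) (γ.projParam (c b)),
      abs_sub_le (γ.projParam (c a')) (γ.projParam (c b')) (γ.projParam (c b))]
  have hlen : b' - a' ≤ w + 2 * D := by
    have hab_le := hc.sub_le_infDist_add_abs_projParam_sub hab γ
    have hw0 : 0 ≤ w := abs_nonneg _
    rcases hba' with rfl | hba' <;> rcases hab' with rfl | hab' <;> linarith [hb'.1, hb'.2]
  calc w ≤ B + B * ((b' - a') / D + 1) + B := hw
    _ ≤ B + B * ((w + 2 * D) / D + 1) + B := by gcongr
    _ = 5 * B + B * w / D := by field_simp; ring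

theorem GeodLine.IsContracting.abs_projParam_sub_le_of_forall_lt_infDist (hB : 0 ≤ B)
    (h : γ.IsContracting B) (hab : a ≤ b) (hc : IsGeodesicOn c (Icc a b))
    (hfar : ∀ t ∈ Icc a b, 6 * B + 1 < Metric.infDist (c t) (range γ.1)) :
    |γ.projParam (c a) - γ.projParam (c b)| ≤ 6 * B := by
  have hle := h.abs_projParam_sub_le_add_div hB (by positivity) hab hc hfar
  set w := |γ.projParam (c a) - γ.projParam (c b)|
  have hdiv : B * w / (6 * B + 1) ≤ w / 6 := by
    rw [div_le_div_iff₀ (by positivity) (by norm_num)]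
    linarith [show 0 ≤ w from abs_nonneg _]
  linarith

theorem GeodLine.IsContracting.sub_le_of_forall_lt_infDist (hB : 0 ≤ B) (h : γ.IsContracting B)
    {K : ℝ} (hab : a ≤ b) (hc : IsGeodesicOn c (Icc a b))
    (hfar : ∀ t ∈ Icc a b, 6 * B + 2 < Metric.infDist (c t) (range γ.1))
    (ha : Metric.infDist (c a) (range γ.1) ≤ K) (hb : Metric.infDist (c b) (range γ.1) ≤ K) :
    b - a ≤ 3 * K + 2 * B := by
  have hproj := h.abs_projParam_sub_le_mul hB (by positivity) hab hc hfar
  have hlen := hc.sub_le_infDist_add_abs_projParam_sub hab γ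
  have hmul : B * ((b - a) / (6 * B + 2)) ≤ (b - a) / 6 := by
    rw [← mul_div_assoc, div_le_div_iff₀ (by positivity) (by norm_num)]
    nlinarith
  linarith [Metric.infDist_nonneg.trans ha]

theorem GeodLine.IsContracting.exists_infDist_le_of_lt_abs_projParam_sub (hB : 0 ≤ B)
    (h : γ.IsContracting B) (hab : a ≤ b) (hc : IsGeodesicOn c (Icc a b))
    (hlt : 6 * B < |γ.projParam (c a) - γ.projParam (c b)|) :
    ∃ t ∈ Icc a b, Metric.infDist (c t) (range γ.1) ≤ 6 * B + 1 := by
  contrapose! hlt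
  exact h.abs_projParam_sub_le_of_forall_lt_infDist hB hab hc hlt

variable [IsCAT0 X]

theorem GeodLine.IsContracting.infDist_le_of_mem_Icc (hB : 0 ≤ B) (h : γ.IsContracting B)
    {K : ℝ} (hc : IsGeodesicOn c (Icc a b))
    (ha : Metric.infDist (c a) (range γ.1) ≤ K) (hb : Metric.infDist (c b) (range γ.1) ≤ K)
    {t : ℝ} (ht : t ∈ Icc (a + (3 * K + 2 * B + 1)) (b - (3 * K + 2 * B + 1))) :
    Metric.infDist (c t) (range γ.1) ≤ 6 * B + 2 := by
  have hK : 0 ≤ K := Metric.infDist_nonneg.trans ha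
  have hconv := hc.convexOn_infDist_range (convex_Icc a b) γ
  have hat : a ≤ t := by linarith [ht.1]
  have htb : t ≤ b := by linarith [ht.2]
  have htK : Metric.infDist (c t) (range γ.1) ≤ K :=
    (hconv.le_max_of_mem_Icc (left_mem_Icc.2 (hat.trans htb)) (right_mem_Icc.2 (hat.trans htb))
      ⟨hat, htb⟩).trans (max_le ha hb)
  by_contra! hlt
  have hfar : (∀ s ∈ Icc a t, 6 * B + 2 < Metric.infDist (c s) (range γ.1)) ∨
      ∀ s ∈ Icc t b, 6 * B + 2 < Metric.infDist (c s) (range γ.1) := by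
    by_contra! ⟨⟨s, hs, hs'⟩, r, hr, hr'⟩
    have hmax := hconv.le_max_of_mem_Icc (x := s) (y := r) (z := t) ⟨hs.1, hs.2.trans htb⟩
      ⟨hat.trans hr.1, hr.2⟩ ⟨hs.2, hr.1⟩
    exact hlt.not_ge (hmax.trans (max_le hs' hr'))
  rcases hfar with hfar | hfar
  · linarith [ht.1, h.sub_le_of_forall_lt_infDist hB hat (hc.mono (Icc_subset_Icc_right htb)) hfar
      ha htK]
  · linarith [ht.2, h.sub_le_of_forall_lt_infDist hB htb (hc.mono (Icc_subset_Icc_left hat)) hfar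
      htK hb]

theorem GeodLine.IsContracting.exists_first_infDist_le (hB : 0 ≤ B) (h : γ.IsContracting B)
    (hc : IsGeodesicOn c (Icc a b))
    (hclose : ∃ t ∈ Icc a b, Metric.infDist (c t) (range γ.1) ≤ 6 * B + 1) :
    ∃ t ∈ Icc a b, Metric.infDist (c t) (range γ.1) ≤ 6 * B + 1 ∧
      |γ.projParam (c a) - γ.projParam (c t)| ≤ 6 * B := by
  have hcont : ContinuousOn (fun t => Metric.infDist (c t) (range γ.1)) (Icc a b) :=
    (Metric.continuous_infDist_pt _).comp_continuousOn hc.continuousOn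
  have hcompact : IsCompact (Icc a b ∩ (fun t => Metric.infDist (c t) (range γ.1)) ⁻¹'
      Iic (6 * B + 1)) :=
    isCompact_Icc.of_isClosed_subset (hcont.preimage_isClosed_of_isClosed isClosed_Icc isClosed_Iic)
      inter_subset_left
  obtain ⟨t₀, ⟨ht₀, hle⟩, hmin⟩ := hcompact.exists_isLeast hclose
  refine ⟨t₀, ht₀, hle, ?_⟩
  rcases ht₀.1.eq_or_lt with rfl | hlt
  · rw [sub_self, abs_zero]
    positivity
  have hbefore : ∀ t ∈ Ico a t₀, |γ.projParam (c a) - γ.projParam (c t)| ≤ 6 * B := by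
    intro t ht
    have hsub : Icc a t ⊆ Icc a b := Icc_subset_Icc_right (ht.2.le.trans ht₀.2)
    refine h.abs_projParam_sub_le_of_forall_lt_infDist hB ht.1 (hc.mono hsub) fun s hs => ?_
    exact not_le.1 fun hs' => (hs.2.trans_lt ht.2).not_ge (hmin ⟨hsub hs, hs'⟩)
  have hproj : ContinuousOn (fun t => |γ.projParam (c a) - γ.projParam (c t)|) (Icc a b) :=
    (continuousOn_const.sub (γ.continuous_projParam.comp_continuousOn hc.continuousOn)).abs
  refine ContinuousWithinAt.closure_le (s := Ico a t₀) ?_ ((hproj t₀ ht₀).mono fun t ht => ?_)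
    continuousWithinAt_const hbefore
  · rw [closure_Ico hlt.ne]
    exact right_mem_Icc.2 hlt.le
  · exact ⟨ht.1, ht.2.le.trans ht₀.2⟩

theorem GeodLine.IsContracting.exists_last_infDist_le (hB : 0 ≤ B) (h : γ.IsContracting B)
    (hc : IsGeodesicOn c (Icc a b))
    (hclose : ∃ t ∈ Icc a b, Metric.infDist (c t) (range γ.1) ≤ 6 * B + 1) :
    ∃ t ∈ Icc a b, Metric.infDist (c t) (range γ.1) ≤ 6 * B + 1 ∧
      |γ.projParam (c t) - γ.projParam (c b)| ≤ 6 * B := by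
  have hc' : IsGeodesicOn (fun t => c (-t)) (Icc (-b) (-a)) :=
    hc.comp_neg.mono fun t ht => neg_mem_Icc_iff.2 ht
  obtain ⟨s, hs, hs'⟩ := hclose
  obtain ⟨t, ht, htle, habs⟩ := h.exists_first_infDist_le hB hc'
    ⟨-s, neg_mem_Icc_iff.2 (by simpa only [neg_neg] using hs), by rwa [neg_neg]⟩
  rw [neg_neg, abs_sub_comm] at habs
  exact ⟨-t, neg_mem_Icc_iff.2 ht, htle, habs⟩

end

section

variable {X : Type u} [MetricSpace X]

/-! ### Reversal of lines -/

theorem GeodLine.reverse_apply (γ : GeodLine X) (t : ℝ) : γ.reverse.1 t = γ.1 (-t) := rfl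

theorem mem_fellowSet {B : ℝ} {ζ ζ' : GeodLine X} {t : ℝ} :
    t ∈ fellowSet B ζ ζ' ↔ Metric.infDist (ζ.1 t) (range ζ'.1) ≤ 6 * B + 2 := Iff.rfl

theorem fellowSet_reverse_left (B : ℝ) (ζ ζ' : GeodLine X) :
    fellowSet B ζ.reverse ζ' = Neg.neg ⁻¹' fellowSet B ζ ζ' := rfl

theorem neg_mem_fellowSet_reverse_left {B : ℝ} {ζ ζ' : GeodLine X} {t : ℝ} :
    -t ∈ fellowSet B ζ.reverse ζ' ↔ t ∈ fellowSet B ζ ζ' := by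
  rw [fellowSet_reverse_left, mem_preimage, neg_neg]

theorem fellowSet_reverse_right (B : ℝ) (ζ ζ' : GeodLine X) :
    fellowSet B ζ ζ'.reverse = fellowSet B ζ ζ' := by
  unfold fellowSet
  rw [ζ'.range_reverse]

theorem fellowRight_reverse_left (B : ℝ) (ζ ζ' : GeodLine X) :
    fellowRight B ζ.reverse ζ' = -fellowLeft B ζ ζ' := by
  refine (isLUB_sSup _).unique ⟨?_, fun e he => EReal.neg_le.1 (le_sInf ?_)⟩
  · rintro _ ⟨t, ht, rfl⟩
    exact EReal.le_neg.1 (sInf_le ⟨-t, ht, EReal.coe_neg t⟩)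
  · rintro _ ⟨t, ht, rfl⟩
    exact EReal.neg_le.1 (he ⟨-t, neg_mem_fellowSet_reverse_left.2 ht, EReal.coe_neg t⟩)

theorem fellowLeft_reverse_left (B : ℝ) (ζ ζ' : GeodLine X) :
    fellowLeft B ζ.reverse ζ' = -fellowRight B ζ ζ' := by
  rw [← neg_eq_iff_eq_neg, ← fellowRight_reverse_left, ζ.reverse_reverse]

theorem fellowRight_reverse_right (B : ℝ) (ζ ζ' : GeodLine X) :
    fellowRight B ζ ζ'.reverse = fellowRight B ζ ζ' := by
  rw [fellowRight, fellowRight, fellowSet_reverse_right]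

theorem fellowLeft_reverse_right (B : ℝ) (ζ ζ' : GeodLine X) :
    fellowLeft B ζ ζ'.reverse = fellowLeft B ζ ζ' := by
  rw [fellowLeft, fellowLeft, fellowSet_reverse_right]

theorem distOrBusemann_coe (ζ : GeodLine X) (e : ℝ) (z : X) :
    distOrBusemann ζ e z = dist (ζ.1 e) z := by
  rw [distOrBusemann, if_neg (EReal.coe_ne_top e), if_neg (EReal.coe_ne_bot e), EReal.toReal_coe]

theorem distOrBusemann_reverse (ζ : GeodLine X) (e : EReal) (z : X) :
    distOrBusemann ζ.reverse e z = distOrBusemann ζ (-e) z := by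
  have hzero : ζ.reverse.1 0 = ζ.1 0 := congrArg ζ.1 neg_zero
  induction e with
  | top =>
    rw [EReal.neg_top, distOrBusemann, distOrBusemann, if_pos rfl, if_neg bot_ne_top, if_pos rfl,
      hzero, limUnder, limUnder, ← map_neg_atTop, Filter.map_map]
    rfl
  | bot =>
    rw [EReal.neg_bot, distOrBusemann, distOrBusemann, if_neg bot_ne_top, if_pos rfl, if_pos rfl,
      hzero, limUnder, limUnder, ← map_neg_atBot, Filter.map_map]
    rfl
  | coe r => rw [← EReal.coe_neg, distOrBusemann_coe, distOrBusemann_coe, ζ.reverse_apply]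

theorem IsMinParam.comp_neg {f : ℝ → ℝ} {s : EReal} (h : IsMinParam f s) :
    IsMinParam (fun t => f (-t)) (-s) := by
  rcases h with ⟨t, rfl, hmin⟩ | ⟨rfl, hlt⟩ | ⟨rfl, hlt⟩
  · refine .inl ⟨-t, (EReal.coe_neg t).symm, fun u => ?_⟩
    simpa only [neg_neg] using hmin (-u)
  · exact .inr (.inr ⟨EReal.neg_top, fun t => tendsto_neg_atBot_atTop.eventually (hlt (-t))⟩)
  · exact .inr (.inl ⟨EReal.neg_bot, fun t => tendsto_neg_atTop_atBot.eventually (hlt (-t))⟩)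

theorem ProjectsTo.reverse_left {ζ ζ' : GeodLine X} {e s : EReal} (h : ProjectsTo ζ ζ' e s) :
    ProjectsTo ζ.reverse ζ' e (-s) :=
  IsMinParam.comp_neg h

theorem projectsTo_reverse_left {ζ ζ' : GeodLine X} {e s : EReal} :
    ProjectsTo ζ.reverse ζ' e s ↔ ProjectsTo ζ ζ' e (-s) := by
  refine ⟨fun h => ?_, fun h => ?_⟩
  · simpa only [ζ.reverse_reverse] using h.reverse_left
  · simpa only [neg_neg] using h.reverse_left

theorem projectsTo_reverse_right {ζ ζ' : GeodLine X} {e s : EReal} :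
    ProjectsTo ζ ζ'.reverse e s ↔ ProjectsTo ζ ζ' (-e) s := by
  simp only [ProjectsTo, distOrBusemann_reverse]

/-! ### The interval along which a line follows another one -/

theorem isClosed_fellowSet (B : ℝ) (ζ ζ' : GeodLine X) : IsClosed (fellowSet B ζ ζ') :=
  isClosed_le ((Metric.continuous_infDist_pt _).comp ζ.2.continuous) continuous_const

theorem sSup_coe_image_eq_coe_or_eq_top {S : Set ℝ} (hclosed : IsClosed S) (hne : S.Nonempty) :
    (∃ b : ℝ, sSup ((fun t : ℝ => (t : EReal)) '' S) = b ∧ IsGreatest S b) ∨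
      sSup ((fun t : ℝ => (t : EReal)) '' S) = ⊤ ∧ ∀ q, ∃ u ∈ S, q < u := by
  by_cases hbdd : BddAbove S
  · have hgreatest := hclosed.isGreatest_csSup hne hbdd
    refine .inl ⟨sSup S, IsGreatest.csSup_eq ⟨mem_image_of_mem _ hgreatest.1, ?_⟩, hgreatest⟩
    exact forall_mem_image.2 fun u hu => EReal.coe_le_coe_iff.2 (hgreatest.2 hu)
  · have hlt : ∀ q, ∃ u ∈ S, q < u := not_bddAbove_iff.1 hbdd
    refine .inr ⟨EReal.eq_top_iff_forall_lt _ |>.2 fun q => ?_, hlt⟩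
    obtain ⟨u, hu, hqu⟩ := hlt q
    exact (EReal.coe_lt_coe_iff.2 hqu).trans_le (le_sSup (mem_image_of_mem _ hu))

theorem abs_sub_sub_le_of_mem_fellowSet {B : ℝ} {ζ ζ' : GeodLine X} {u v : ℝ}
    (hu : u ∈ fellowSet B ζ ζ') (hv : v ∈ fellowSet B ζ ζ') :
    |u - v| - 2 * (6 * B + 2) ≤ |ζ'.projParam (ζ.1 u) - ζ'.projParam (ζ.1 v)| := by
  have hdist := ζ'.dist_le_infDist_add_abs_projParam_sub (ζ.1 u) (ζ.1 v)
  rw [ζ.dist_eq] at hdist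
  linarith [mem_fellowSet.1 hu, mem_fellowSet.1 hv]

-- If `h b < h q₀`, the lower bounds `hI` for `h q₁ - h q₀` and `h q₀ - h b` add up to more than the
-- Lipschitz bound `b - q₁` for `h q₁ - h b`.
theorem sub_sub_le_sub_of_abs_sub_le {h : ℝ → ℝ} {I : Set ℝ} {K : ℝ}
    (hl : ∀ u v, |h u - h v| ≤ |u - v|)
    (hI : ∀ u ∈ I, ∀ v ∈ I, |u - v| - 2 * K ≤ |h u - h v|) {q₀ q₁ b : ℝ} (h₀ : q₀ ∈ I)
    (h₁ : q₁ ∈ I) (hb : b ∈ I) (hq : 2 * K < q₁ - q₀) (hlt : h q₀ < h q₁) (hqb : q₁ ≤ b) :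
    b - q₀ - 2 * K ≤ h b - h q₀ := by
  have hK : 0 ≤ K := by
    have := hI q₀ h₀ q₀ h₀
    simp only [sub_self, abs_zero] at this
    linarith
  have hI₁ := hI q₁ h₁ q₀ h₀
  have hIb := hI b hb q₀ h₀
  have hl₁ := (le_abs_self _).trans (hl q₁ b)
  rw [abs_of_pos (sub_pos.2 hlt), abs_of_pos (by linarith)] at hI₁
  rw [abs_of_pos (a := b - q₀) (by linarith)] at hIb
  rw [abs_sub_comm, abs_of_nonneg (sub_nonneg.2 hqb)] at hl₁
  rcases le_or_gt 0 (h b - h q₀) with hs | hs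
  · rwa [abs_of_nonneg hs] at hIb
  · rw [abs_of_neg hs] at hIb
    linarith

theorem tendsto_distOrBusemann_top (ζ : GeodLine X) (z : X) :
    Tendsto (fun u => dist (ζ.1 u) z - u) atTop (𝓝 (distOrBusemann ζ ⊤ z)) := by
  have hanti : Antitone fun u => dist (ζ.1 u) z - u := fun u v huv => by
    have htri := dist_triangle (ζ.1 v) (ζ.1 u) z
    rw [ζ.dist_eq, abs_of_nonneg (sub_nonneg.2 huv)] at htri
    change _ - _ ≤ _ - _
    linarith
  have hbdd : BddBelow (range fun u => dist (ζ.1 u) z - u) := by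
    refine ⟨-dist z (ζ.1 0), forall_mem_range.2 fun u => ?_⟩
    have htri := dist_triangle (ζ.1 u) z (ζ.1 0)
    rw [ζ.dist_eq, sub_zero] at htri
    linarith [le_abs_self u]
  have hlim := tendsto_atTop_ciInf hanti hbdd
  have hlim' : Tendsto (fun u => dist (ζ.1 u) z - dist (ζ.1 u) (ζ.1 0)) atTop
      (𝓝 (⨅ u, dist (ζ.1 u) z - u)) := by
    refine hlim.congr' ?_
    filter_upwards [eventually_ge_atTop 0] with u hu
    rw [ζ.dist_eq, sub_zero, abs_of_nonneg hu]
  rwa [distOrBusemann, if_pos rfl, hlim'.limUnder_eq]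

theorem distOrBusemann_top_le {ζ ζ' : GeodLine X} {K : ℝ}
    (hK : ∀ᶠ u in atTop, Metric.infDist (ζ.1 u) (range ζ'.1) ≤ K)
    (hlim : Tendsto (fun u => ζ'.projParam (ζ.1 u)) atTop atTop) {t t' : ℝ} (htt' : t ≤ t') :
    distOrBusemann ζ ⊤ (ζ'.1 t') ≤ distOrBusemann ζ ⊤ (ζ'.1 t) + (2 * K - (t' - t)) := by
  refine le_of_tendsto_of_tendsto (tendsto_distOrBusemann_top ζ (ζ'.1 t'))
    ((tendsto_distOrBusemann_top ζ (ζ'.1 t)).add_const _) ?_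
  filter_upwards [hK, hlim.eventually_ge_atTop t'] with u hu hu'
  rw [ζ'.infDist_range_eq] at hu
  have htri' := dist_triangle (ζ.1 u) (ζ'.1 (ζ'.projParam (ζ.1 u))) (ζ'.1 t')
  have htri := dist_triangle_left (ζ'.1 (ζ'.projParam (ζ.1 u))) (ζ'.1 t) (ζ.1 u)
  rw [ζ'.dist_eq, abs_of_nonneg (by linarith)] at htri htri'
  linarith

theorem projectsTo_top_iff {ζ ζ' : GeodLine X} {K : ℝ}
    (hK : ∀ᶠ u in atTop, Metric.infDist (ζ.1 u) (range ζ'.1) ≤ K)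
    (hlim : Tendsto (fun u => ζ'.projParam (ζ.1 u)) atTop atTop) {s : EReal} :
    ProjectsTo ζ' ζ ⊤ s ↔ s = ⊤ := by
  have hle := fun t t' => distOrBusemann_top_le hK hlim (t := t) (t' := t')
  have hK0 : 0 ≤ K := Metric.infDist_nonneg.trans hK.exists.choose_spec
  have htop : ∀ t, ∀ᶠ u in atTop, distOrBusemann ζ ⊤ (ζ'.1 u) < distOrBusemann ζ ⊤ (ζ'.1 t) := by
    intro t
    filter_upwards [eventually_gt_atTop (t + 2 * K)] with u hu
    linarith [hle t u (by linarith)]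
  constructor
  · rintro (⟨t, rfl, hmin⟩ | ⟨rfl, -⟩ | ⟨-, hlt⟩)
    · obtain ⟨u, hu⟩ := (htop t).exists
      exact absurd (hmin u) (not_le.2 hu)
    · rfl
    · obtain ⟨u, hu, hu'⟩ := ((hlt 0).and (eventually_lt_atBot (-2 * K))).exists
      linarith [hle u 0 (by linarith)]
  · rintro rfl
    exact .inr (.inl ⟨rfl, htop⟩)

variable [IsCAT0 X]

theorem GeodLine.projParam_reverse (γ : GeodLine X) (p : X) :
    γ.reverse.projParam p = -γ.projParam p :=
  γ.reverse.projParam_eq_of_forall_dist_le fun u => by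
    rw [γ.reverse_apply, neg_neg]
    exact γ.dist_projParam_le p (-u)

theorem ordConnected_fellowSet (B : ℝ) (ζ ζ' : GeodLine X) : (fellowSet B ζ ζ').OrdConnected := by
  have hconv := ((ζ.isGeodesicOn univ).convexOn_infDist_range convex_univ ζ').convex_le (6 * B + 2)
  rw [sep_univ] at hconv
  exact hconv.ordConnected

theorem projectsTo_coe_iff {ζ ζ' : GeodLine X} {e : ℝ} {s : EReal} :
    ProjectsTo ζ ζ' e s ↔ s = (ζ.projParam (ζ'.1 e) : ℝ) := by
  simp only [ProjectsTo, distOrBusemann_coe]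
  have hmin := ζ.dist_projParam_le (ζ'.1 e)
  constructor
  · rintro (⟨t, rfl, ht⟩ | ⟨-, hlt⟩ | ⟨-, hlt⟩)
    · rw [ζ.projParam_eq_of_forall_dist_le ht]
    · obtain ⟨u, hu⟩ := (hlt (ζ.projParam (ζ'.1 e))).exists
      exact absurd (hmin u) (not_le.2 hu)
    · obtain ⟨u, hu⟩ := (hlt (ζ.projParam (ζ'.1 e))).exists
      exact absurd (hmin u) (not_le.2 hu)
  · rintro rfl
    exact .inl ⟨_, rfl, hmin⟩

theorem GeodLine.abs_projParam_apply_sub_le (ζ ζ' : GeodLine X) (u v : ℝ) :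
    |ζ'.projParam (ζ.1 u) - ζ'.projParam (ζ.1 v)| ≤ |u - v| :=
  (ζ'.abs_projParam_sub_projParam_le _ _).trans_eq (ζ.dist_eq u v)

variable {B : ℝ} {ζ ζ' : GeodLine X} {q₀ q₁ : ℝ}

theorem sub_sub_le_projParam_sub_of_mem_fellowSet (h₀ : q₀ ∈ fellowSet B ζ ζ')
    (h₁ : q₁ ∈ fellowSet B ζ ζ') (hq : 2 * (6 * B + 2) < q₁ - q₀)
    (hlt : ζ'.projParam (ζ.1 q₀) < ζ'.projParam (ζ.1 q₁)) {b : ℝ} (hb : b ∈ fellowSet B ζ ζ')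
    (hqb : q₁ ≤ b) :
    b - q₀ - 2 * (6 * B + 2) ≤ ζ'.projParam (ζ.1 b) - ζ'.projParam (ζ.1 q₀) :=
  sub_sub_le_sub_of_abs_sub_le (h := fun u => ζ'.projParam (ζ.1 u))
    (ζ.abs_projParam_apply_sub_le ζ') (fun _ hu _ hv => abs_sub_sub_le_of_mem_fellowSet hu hv)
    h₀ h₁ hb hq hlt hqb

theorem exists_projectsTo_fellowRight_of_lt (h₀ : q₀ ∈ fellowSet B ζ ζ')
    (h₁ : q₁ ∈ fellowSet B ζ ζ') (hq : 2 * (6 * B + 2) < q₁ - q₀)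
    (hlt : ζ'.projParam (ζ.1 q₀) < ζ'.projParam (ζ.1 q₁)) :
    ∃ t₀ : EReal, (∀ t, ProjectsTo ζ' ζ (fellowRight B ζ ζ') t ↔ t = t₀) ∧
      ((ζ'.projParam (ζ.1 q₁) - 2 * (6 * B + 2) : ℝ) : EReal) ≤ t₀ := by
  have hinc := fun b => sub_sub_le_projParam_sub_of_mem_fellowSet h₀ h₁ hq hlt (b := b)
  have hB : 0 ≤ 6 * B + 2 := Metric.infDist_nonneg.trans h₀
  rcases sSup_coe_image_eq_coe_or_eq_top (isClosed_fellowSet B ζ ζ') ⟨q₀, h₀⟩ with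
    ⟨b, hb, hgreatest⟩ | ⟨htop, hunbounded⟩
  · refine ⟨(ζ'.projParam (ζ.1 b) : ℝ), fun t => ?_, EReal.coe_le_coe_iff.2 ?_⟩
    · rw [fellowRight, hb, projectsTo_coe_iff]
    · have hqb := hgreatest.2 h₁
      have hl := (le_abs_self _).trans (ζ.abs_projParam_apply_sub_le ζ' q₁ q₀)
      rw [abs_of_pos (by linarith)] at hl
      linarith [hinc b hgreatest.1 hqb]
  · have hmem : ∀ q, q₁ ≤ q → q ∈ fellowSet B ζ ζ' := fun q hq' => by
      obtain ⟨u, hu, hqu⟩ := hunbounded q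
      exact (ordConnected_fellowSet B ζ ζ').out h₁ hu ⟨hq', hqu.le⟩
    have hlim : Tendsto (fun b => ζ'.projParam (ζ.1 b)) atTop atTop := by
      refine tendsto_atTop_mono' atTop ?_ (tendsto_atTop_add_const_right _
        (ζ'.projParam (ζ.1 q₀) - q₀ - 2 * (6 * B + 2)) tendsto_id)
      filter_upwards [eventually_ge_atTop q₁] with u hu
      rw [id]
      linarith [hinc u (hmem u hu) hu]
    refine ⟨⊤, fun t => ?_, le_top⟩
    rw [fellowRight, htop]
    exact projectsTo_top_iff (K := 6 * B + 2) (eventually_atTop.2 ⟨q₁, hmem⟩) hlim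

theorem exists_projectsTo_fellowRight_of_gt (h₀ : q₀ ∈ fellowSet B ζ ζ')
    (h₁ : q₁ ∈ fellowSet B ζ ζ') (hq : 2 * (6 * B + 2) < q₁ - q₀)
    (hlt : ζ'.projParam (ζ.1 q₁) < ζ'.projParam (ζ.1 q₀)) :
    ∃ t₀ : EReal, (∀ t, ProjectsTo ζ' ζ (fellowRight B ζ ζ') t ↔ t = t₀) ∧
      t₀ ≤ ((ζ'.projParam (ζ.1 q₁) + 2 * (6 * B + 2) : ℝ) : EReal) := by
  rw [← fellowSet_reverse_right] at h₀ h₁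
  rw [← neg_lt_neg_iff, ← ζ'.projParam_reverse, ← ζ'.projParam_reverse] at hlt
  obtain ⟨t₀, huniq, hle⟩ := exists_projectsTo_fellowRight_of_lt h₀ h₁ hq hlt
  refine ⟨-t₀, fun t => ?_, ?_⟩
  · rw [← neg_eq_iff_eq_neg, ← huniq, fellowRight_reverse_right, projectsTo_reverse_left, neg_neg]
  · rwa [EReal.neg_le, ← EReal.coe_neg, neg_add', ← ζ'.projParam_reverse]

theorem exists_projectsTo_fellowLeft_of_lt (h₀ : q₀ ∈ fellowSet B ζ ζ')
    (h₁ : q₁ ∈ fellowSet B ζ ζ') (hq : 2 * (6 * B + 2) < q₁ - q₀)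
    (hlt : ζ'.projParam (ζ.1 q₀) < ζ'.projParam (ζ.1 q₁)) :
    ∃ t₀ : EReal, (∀ t, ProjectsTo ζ' ζ (fellowLeft B ζ ζ') t ↔ t = t₀) ∧
      t₀ ≤ ((ζ'.projParam (ζ.1 q₀) + 2 * (6 * B + 2) : ℝ) : EReal) := by
  obtain ⟨t₀, huniq, hle⟩ := exists_projectsTo_fellowRight_of_gt
    (neg_mem_fellowSet_reverse_left.2 h₁) (neg_mem_fellowSet_reverse_left.2 h₀) (by linarith)
    (by rwa [ζ.reverse_apply, ζ.reverse_apply, neg_neg, neg_neg])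
  rw [ζ.reverse_apply, neg_neg] at hle
  refine ⟨t₀, fun t => ?_, hle⟩
  rw [← huniq, fellowRight_reverse_left, projectsTo_reverse_right, neg_neg]

theorem exists_projectsTo_fellowLeft_of_gt (h₀ : q₀ ∈ fellowSet B ζ ζ')
    (h₁ : q₁ ∈ fellowSet B ζ ζ') (hq : 2 * (6 * B + 2) < q₁ - q₀)
    (hlt : ζ'.projParam (ζ.1 q₁) < ζ'.projParam (ζ.1 q₀)) :
    ∃ t₀ : EReal, (∀ t, ProjectsTo ζ' ζ (fellowLeft B ζ ζ') t ↔ t = t₀) ∧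
      ((ζ'.projParam (ζ.1 q₀) - 2 * (6 * B + 2) : ℝ) : EReal) ≤ t₀ := by
  obtain ⟨t₀, huniq, hle⟩ := exists_projectsTo_fellowRight_of_lt
    (neg_mem_fellowSet_reverse_left.2 h₁) (neg_mem_fellowSet_reverse_left.2 h₀) (by linarith)
    (by rwa [ζ.reverse_apply, ζ.reverse_apply, neg_neg, neg_neg])
  rw [ζ.reverse_apply, neg_neg] at hle
  refine ⟨t₀, fun t => ?_, hle⟩
  rw [← huniq, fellowRight_reverse_left, projectsTo_reverse_right, neg_neg]

theorem coherentlyOriented_iff_projParam_lt (h₀ : q₀ ∈ fellowSet B ζ ζ')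
    (h₁ : q₁ ∈ fellowSet B ζ ζ') (hq : 6 * (6 * B + 2) < q₁ - q₀) :
    CoherentlyOriented B ζ' ζ ↔ ζ'.projParam (ζ.1 q₀) < ζ'.projParam (ζ.1 q₁) := by
  have hB : 0 ≤ 6 * B + 2 := Metric.infDist_nonneg.trans h₀
  have hq' : 2 * (6 * B + 2) < q₁ - q₀ := by linarith
  have habs := abs_sub_sub_le_of_mem_fellowSet h₁ h₀
  rw [abs_of_pos (a := q₁ - q₀) (by linarith)] at habs
  constructor
  · rintro ⟨s, t, hs, ht, hst⟩
    by_contra! hle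
    rw [abs_of_nonpos (sub_nonpos.2 hle)] at habs
    have hlt : ζ'.projParam (ζ.1 q₁) < ζ'.projParam (ζ.1 q₀) := by linarith
    obtain ⟨t₀, huniq_t, ht_le⟩ := exists_projectsTo_fellowRight_of_gt h₀ h₁ hq' hlt
    obtain ⟨s₀, huniq_s, hle_s⟩ := exists_projectsTo_fellowLeft_of_gt h₀ h₁ hq' hlt
    rw [(huniq_s s).1 hs, (huniq_t t).1 ht] at hst
    linarith [EReal.coe_lt_coe_iff.1 (hle_s.trans_lt (hst.trans_le ht_le))]
  · intro hlt
    rw [abs_of_pos (sub_pos.2 hlt)] at habs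
    obtain ⟨t₀, huniq_t, hle_t⟩ := exists_projectsTo_fellowRight_of_lt h₀ h₁ hq' hlt
    obtain ⟨s₀, huniq_s, hs_le⟩ := exists_projectsTo_fellowLeft_of_lt h₀ h₁ hq' hlt
    refine ⟨s₀, t₀, (huniq_s _).2 rfl, (huniq_t _).2 rfl, hs_le.trans_lt (lt_of_lt_of_le ?_ hle_t)⟩
    rw [EReal.coe_lt_coe_iff]
    linarith

end

section

variable {X : Type u} [MetricSpace X]

/-! ### The function `τ_B` in terms of long common intervals -/

theorem ennreal_le_of_forall_ofReal_le {a b : ℝ≥0∞}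
    (h : ∀ T : ℝ, 0 < T → ENNReal.ofReal T ≤ a → ENNReal.ofReal T ≤ b) : a ≤ b := by
  refine ENNReal.le_of_forall_nnreal_lt fun r hr => ?_
  rcases eq_zero_or_pos r with rfl | hr0
  · exact zero_le
  · simpa only [ENNReal.ofReal_coe_nnreal] using h r hr0 (by simpa using hr.le)

theorem distToParam_coe (ζ : GeodLine X) (p : X) (e : ℝ) :
    distToParam ζ p e = ENNReal.ofReal (dist p (ζ.1 e)) := by
  rw [distToParam, if_neg (not_or.2 ⟨EReal.coe_ne_top e, EReal.coe_ne_bot e⟩), EReal.toReal_coe]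

theorem distToParam_top (ζ : GeodLine X) (p : X) : distToParam ζ p ⊤ = ⊤ :=
  if_pos (.inl rfl)

theorem distToParam_bot (ζ : GeodLine X) (p : X) : distToParam ζ p ⊥ = ⊤ :=
  if_pos (.inr rfl)

theorem distToParam_reverse (ζ : GeodLine X) (p : X) (e : EReal) :
    distToParam ζ.reverse p e = distToParam ζ p (-e) := by
  induction e with
  | top => rw [EReal.neg_top, distToParam_top, distToParam_bot]
  | bot => rw [EReal.neg_bot, distToParam_top, distToParam_bot]
  | coe r => rw [← EReal.coe_neg, distToParam_coe, distToParam_coe, ζ.reverse_apply]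

theorem CoherentlyOriented.reverse {B : ℝ} {ζ ζ' : GeodLine X} (h : CoherentlyOriented B ζ ζ') :
    CoherentlyOriented B ζ.reverse ζ'.reverse := by
  obtain ⟨s, t, hs, ht, hst⟩ := h
  refine ⟨-t, -s, ?_, ?_, EReal.neg_lt_neg_iff.2 hst⟩
  · rwa [projectsTo_reverse_left, projectsTo_reverse_right, fellowLeft_reverse_left,
      fellowRight_reverse_right, neg_neg, neg_neg]
  · rwa [projectsTo_reverse_left, projectsTo_reverse_right, fellowRight_reverse_left,
      fellowLeft_reverse_right, neg_neg, neg_neg]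

section CAT0

variable [IsCAT0 X]

theorem ofReal_le_distToParam_fellowRight_iff {B : ℝ} {ζ ζ' : GeodLine X} {p T : ℝ} (hT : 0 ≤ T)
    (hp : p ∈ fellowSet B ζ ζ') :
    ENNReal.ofReal T ≤ distToParam ζ (ζ.1 p) (fellowRight B ζ ζ') ↔ p + T ∈ fellowSet B ζ ζ' := by
  have hord := ordConnected_fellowSet B ζ ζ'
  rcases sSup_coe_image_eq_coe_or_eq_top (isClosed_fellowSet B ζ ζ') ⟨p, hp⟩ with
    ⟨b, hb, hgreatest⟩ | ⟨htop, hunbounded⟩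
  · have hpb := sub_nonneg.2 (hgreatest.2 hp)
    rw [fellowRight, hb, distToParam_coe, ζ.dist_eq, abs_sub_comm, abs_of_nonneg hpb,
      ENNReal.ofReal_le_ofReal_iff hpb]
    exact ⟨fun h => hord.out hp hgreatest.1 ⟨by linarith, by linarith⟩,
      fun h => by linarith [hgreatest.2 h]⟩
  · obtain ⟨u, hu, hlt⟩ := hunbounded (p + T)
    rw [fellowRight, htop, distToParam_top]
    exact ⟨fun _ => hord.out hp hu ⟨by linarith, hlt.le⟩, fun _ => le_top⟩

theorem ofReal_le_distToParam_fellowLeft_iff {B : ℝ} {ζ ζ' : GeodLine X} {p T : ℝ} (hT : 0 ≤ T)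
    (hp : p ∈ fellowSet B ζ ζ') :
    ENNReal.ofReal T ≤ distToParam ζ (ζ.1 p) (fellowLeft B ζ ζ') ↔ p - T ∈ fellowSet B ζ ζ' := by
  have hiff := ofReal_le_distToParam_fellowRight_iff hT (neg_mem_fellowSet_reverse_left.2 hp)
  rwa [distToParam_reverse, fellowRight_reverse_left, neg_neg, ζ.reverse_apply, neg_neg,
    show -p + T = -(p - T) by ring, neg_mem_fellowSet_reverse_left] at hiff

theorem ofReal_le_tauLine_iff {B : ℝ} {x : X} {ζ₁ ζ₂ : GeodLine X} {T : ℝ} (hT : 0 < T) :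
    ENNReal.ofReal T ≤ tauLine B x ζ₁ ζ₂ ↔
      (CoherentlyOriented B ζ₁ ζ₂ ∧ CoherentlyOriented B ζ₂ ζ₁) ∧
      (ζ₁.projParam x - T ∈ fellowSet B ζ₁ ζ₂ ∧ ζ₁.projParam x + T ∈ fellowSet B ζ₁ ζ₂) ∧
      (ζ₂.projParam x - T ∈ fellowSet B ζ₂ ζ₁ ∧ ζ₂.projParam x + T ∈ fellowSet B ζ₂ ζ₁) := by
  rw [tauLine]
  split_ifs with hfellow
  · obtain ⟨-, -, horient₁, horient₂, hmem₁, hmem₂⟩ := hfellow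
    rw [endDist, endDist, le_min_iff, le_min_iff, le_min_iff,
      ofReal_le_distToParam_fellowRight_iff hT.le hmem₁,
      ofReal_le_distToParam_fellowRight_iff hT.le hmem₂,
      ofReal_le_distToParam_fellowLeft_iff hT.le hmem₁,
      ofReal_le_distToParam_fellowLeft_iff hT.le hmem₂]
    exact (and_iff_right ⟨horient₁, horient₂⟩).symm
  · refine iff_of_false (not_le.2 (ENNReal.ofReal_pos.2 hT)) ?_
    rintro ⟨⟨horient₁, horient₂⟩, ⟨hl₁, hr₁⟩, hl₂, hr₂⟩
    have hT' := fun s : ℝ => (⟨by linarith, by linarith⟩ : s ∈ Icc (s - T) (s + T))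
    exact hfellow ⟨⟨_, hl₁⟩, ⟨_, hl₂⟩, horient₁, horient₂,
      (ordConnected_fellowSet B ζ₁ ζ₂).out hl₁ hr₁ (hT' _),
      (ordConnected_fellowSet B ζ₂ ζ₁).out hl₂ hr₂ (hT' _)⟩

theorem tauLine_comm (B : ℝ) (x : X) (ζ₁ ζ₂ : GeodLine X) :
    tauLine B x ζ₁ ζ₂ = tauLine B x ζ₂ ζ₁ := by
  have hle : ∀ ζ₁ ζ₂ : GeodLine X, tauLine B x ζ₁ ζ₂ ≤ tauLine B x ζ₂ ζ₁ := fun ζ₁ ζ₂ =>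
    ennreal_le_of_forall_ofReal_le fun T hT h => by
      rw [ofReal_le_tauLine_iff hT] at h ⊢
      exact ⟨h.1.symm, h.2.symm⟩
  exact le_antisymm (hle _ _) (hle _ _)

theorem tauLine_reverse (B : ℝ) (x : X) (ζ₁ ζ₂ : GeodLine X) :
    tauLine B x ζ₁.reverse ζ₂.reverse = tauLine B x ζ₁ ζ₂ := by
  have hle : ∀ ζ₁ ζ₂ : GeodLine X, tauLine B x ζ₁ ζ₂ ≤ tauLine B x ζ₁.reverse ζ₂.reverse := by
    refine fun ζ₁ ζ₂ => ennreal_le_of_forall_ofReal_le fun T hT h => ?_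
    rw [ofReal_le_tauLine_iff hT] at h ⊢
    obtain ⟨⟨horient₁, horient₂⟩, hmem₁, hmem₂⟩ := h
    simp only [fellowSet_reverse_left, fellowSet_reverse_right, GeodLine.projParam_reverse,
      mem_preimage, neg_sub, sub_neg_eq_add, neg_add_eq_sub]
    rw [add_comm T, add_comm T]
    exact ⟨⟨horient₁.reverse, horient₂.reverse⟩, hmem₁.symm, hmem₂.symm⟩
  refine le_antisymm ?_ (hle ζ₁ ζ₂)
  simpa only [GeodLine.reverse_reverse] using hle ζ₁.reverse ζ₂.reverse

theorem tauLine_le_add_dist (B : ℝ) (x y : X) (ζ₁ ζ₂ : GeodLine X) :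
    tauLine B x ζ₁ ζ₂ ≤ tauLine B y ζ₁ ζ₂ + ENNReal.ofReal (dist x y) := by
  refine ennreal_le_of_forall_ofReal_le fun T hT h => ?_
  rcases le_or_gt T (dist x y) with hle | hlt
  · exact le_add_left (ENNReal.ofReal_le_ofReal hle)
  rw [← tsub_le_iff_right, ← ENNReal.ofReal_sub _ dist_nonneg,
    ofReal_le_tauLine_iff (sub_pos.2 hlt)]
  rw [ofReal_le_tauLine_iff hT] at h
  obtain ⟨horient, ⟨hl₁, hr₁⟩, hl₂, hr₂⟩ := h
  have hproj₁ := abs_le.1 (ζ₁.abs_projParam_sub_projParam_le x y)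
  have hproj₂ := abs_le.1 (ζ₂.abs_projParam_sub_projParam_le x y)
  have hord₁ := (ordConnected_fellowSet B ζ₁ ζ₂).out hl₁ hr₁
  have hord₂ := (ordConnected_fellowSet B ζ₂ ζ₁).out hl₂ hr₂
  exact ⟨horient, ⟨hord₁ ⟨by linarith, by linarith⟩, hord₁ ⟨by linarith, by linarith⟩⟩,
    hord₂ ⟨by linarith, by linarith⟩, hord₂ ⟨by linarith, by linarith⟩⟩

theorem tau_comm (B : ℝ) (x : X) (α β : VisualBoundary X × VisualBoundary X) :
    tau B x α β = tau B x β α := by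
  have hle : ∀ α β : VisualBoundary X × VisualBoundary X, tau B x α β ≤ tau B x β α := by
    refine fun α β => le_iInf₂ fun ζ₁ h₁ => le_iInf₂ fun ζ₂ h₂ => ?_
    rw [tauLine_comm]
    exact iInf₂_le_of_le ζ₂ h₂ (iInf₂_le ζ₁ h₁)
  exact le_antisymm (hle _ _) (hle _ _)

theorem tau_swap (B : ℝ) (x : X) (α β : VisualBoundary X × VisualBoundary X) :
    tau B x α.swap β.swap = tau B x α β := by
  have hle : ∀ α β : VisualBoundary X × VisualBoundary X,
      tau B x α β ≤ tau B x α.swap β.swap := by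
    refine fun α β => le_iInf₂ fun ζ₁ h₁ => le_iInf₂ fun ζ₂ h₂ => ?_
    rw [← tauLine_reverse]
    exact iInf₂_le_of_le ζ₁.reverse h₁.reverse (iInf₂_le ζ₂.reverse h₂.reverse)
  exact le_antisymm (hle α.swap β.swap) (hle α β)

theorem tau_le_add_dist (B : ℝ) (x y : X) (α β : VisualBoundary X × VisualBoundary X) :
    tau B x α β ≤ tau B y α β + ENNReal.ofReal (dist x y) := by
  rw [← tsub_le_iff_right]
  refine le_iInf₂ fun ζ₁ h₁ => le_iInf₂ fun ζ₂ h₂ => ?_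
  rw [tsub_le_iff_right]
  exact (iInf₂_le_of_le ζ₁ h₁ (iInf₂_le ζ₂ h₂)).trans (tauLine_le_add_dist B x y ζ₁ ζ₂)

end CAT0

/-! ### Isometries -/

theorem GeodLine.map_apply (g : X ≃ᵢ X) (γ : GeodLine X) (t : ℝ) : (γ.map g).1 t = g (γ.1 t) := rfl

theorem GeodLine.range_map (g : X ≃ᵢ X) (γ : GeodLine X) : range (γ.map g).1 = g '' range γ.1 :=
  range_comp g γ.1

theorem fellowSet_map (g : X ≃ᵢ X) (B : ℝ) (ζ ζ' : GeodLine X) :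
    fellowSet B (ζ.map g) (ζ'.map g) = fellowSet B ζ ζ' := by
  ext t
  rw [mem_fellowSet, mem_fellowSet, GeodLine.range_map, GeodLine.map_apply,
    Metric.infDist_image g.isometry]

theorem distOrBusemann_map (g : X ≃ᵢ X) (ζ : GeodLine X) (e : EReal) (z : X) :
    distOrBusemann (ζ.map g) e (g z) = distOrBusemann ζ e z := by
  simp only [distOrBusemann, GeodLine.map_apply, g.dist_eq]

theorem projectsTo_map (g : X ≃ᵢ X) {ζ ζ' : GeodLine X} {e s : EReal} :
    ProjectsTo (ζ.map g) (ζ'.map g) e s ↔ ProjectsTo ζ ζ' e s := by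
  simp only [ProjectsTo, GeodLine.map_apply, distOrBusemann_map]

theorem coherentlyOriented_map (g : X ≃ᵢ X) (B : ℝ) (ζ ζ' : GeodLine X) :
    CoherentlyOriented B (ζ.map g) (ζ'.map g) ↔ CoherentlyOriented B ζ ζ' := by
  simp only [CoherentlyOriented, fellowLeft, fellowRight, projectsTo_map, fellowSet_map]

theorem VisualBoundary.map_symm_map (g : X ≃ᵢ X) (ξ : VisualBoundary X) :
    VisualBoundary.map g.symm (VisualBoundary.map g ξ) = ξ := by
  induction ξ using Quotient.inductionOn with
  | h r =>
    exact congrArg GeodRay.endpoint <| Subtype.ext <| ContinuousMap.ext fun t =>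
      g.symm_apply_apply (r.1 t)

theorem ContractingPairs.map_symm_map {B : ℝ} (g : X ≃ᵢ X) (α : ContractingPairs X B) :
    ContractingPairs.map g.symm (ContractingPairs.map g α) = α :=
  Subtype.ext (Prod.ext (VisualBoundary.map_symm_map g _) (VisualBoundary.map_symm_map g _))

theorem ContractingPairs.map_bijective {B : ℝ} (g : X ≃ᵢ X) :
    Function.Bijective (ContractingPairs.map (B := B) g) :=
  Function.bijective_iff_has_inverse.2 ⟨ContractingPairs.map g.symm,
    ContractingPairs.map_symm_map g, ContractingPairs.map_symm_map g.symm⟩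

theorem ContractingPairs.flip_involutive {B : ℝ} :
    Function.Involutive (ContractingPairs.flip : ContractingPairs X B → ContractingPairs X B) :=
  fun _ => Subtype.ext (Prod.swap_swap _)

variable [IsCAT0 X]

theorem GeodLine.projParam_map (g : X ≃ᵢ X) (γ : GeodLine X) (p : X) :
    (γ.map g).projParam (g p) = γ.projParam p :=
  (γ.map g).projParam_eq_of_forall_dist_le fun u => by
    rw [γ.map_apply, γ.map_apply, g.dist_eq, g.dist_eq]
    exact γ.dist_projParam_le p u

theorem tauLine_map (g : X ≃ᵢ X) (B : ℝ) (x : X) (ζ₁ ζ₂ : GeodLine X) :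
    tauLine B (g x) (ζ₁.map g) (ζ₂.map g) = tauLine B x ζ₁ ζ₂ := by
  refine le_antisymm ?_ ?_ <;> refine ennreal_le_of_forall_ofReal_le fun T hT h => ?_ <;>
  · rw [ofReal_le_tauLine_iff hT] at h ⊢
    simpa only [coherentlyOriented_map, fellowSet_map, GeodLine.projParam_map] using h

theorem tau_map {B : ℝ} (g : X ≃ᵢ X) (x : X) (α β : ContractingPairs X B) :
    tau B (g x) (ContractingPairs.map g α).1 (ContractingPairs.map g β).1 = tau B x α.1 β.1 := by
  have hle : ∀ (g : X ≃ᵢ X) (x : X) (α β : ContractingPairs X B),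
      tau B (g x) (ContractingPairs.map g α).1 (ContractingPairs.map g β).1 ≤
        tau B x α.1 β.1 := by
    refine fun g x α β => le_iInf₂ fun ζ₁ h₁ => le_iInf₂ fun ζ₂ h₂ => ?_
    rw [← tauLine_map g]
    exact iInf₂_le_of_le (ζ₁.map g) (h₁.map g) (iInf₂_le (ζ₂.map g) (h₂.map g))
  refine le_antisymm (hle g x α β) ?_
  simpa only [g.symm_apply_apply, ContractingPairs.map_symm_map] using
    hle g.symm (g x) (ContractingPairs.map g α) (ContractingPairs.map g β)

end

section

variable {X : Type u} [MetricSpace X]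

/-! ### Fellow travelling lines -/

/-- The lines `ζ` and `ζ'` stay within `K` of each other up to time `T` on both sides of the
projections of `x`, when both are parametrized by the signed distance from these projections. This
replaces the function `τ_B` by a relation that is transitive up to a change of `K`. -/
def Fellow (K T : ℝ) (x : X) (ζ ζ' : GeodLine X) : Prop :=
  ∀ t, |t| ≤ T → dist (ζ.1 (ζ.projParam x + t)) (ζ'.1 (ζ'.projParam x + t)) ≤ K

section Metric

variable {K K' T T' : ℝ} {x : X} {ζ ζ' ζ'' : GeodLine X}

theorem Fellow.symm (h : Fellow K T x ζ ζ') : Fellow K T x ζ' ζ :=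
  fun t ht => (dist_comm _ _).trans_le (h t ht)

theorem Fellow.trans (h : Fellow K T x ζ ζ') (h' : Fellow K' T x ζ' ζ'') :
    Fellow (K + K') T x ζ ζ'' :=
  fun t ht => (dist_triangle _ _ _).trans (add_le_add (h t ht) (h' t ht))

theorem Fellow.mono (h : Fellow K T x ζ ζ') (hT : T' ≤ T) : Fellow K T' x ζ ζ' :=
  fun t ht => h t (ht.trans hT)

theorem fellow_of_forall_dist_le (hK : ∀ t, dist (ζ.1 t) (ζ'.1 t) ≤ K) (x : X) (T : ℝ) :
    Fellow (K + |ζ.projParam x - ζ'.projParam x|) T x ζ ζ' := fun t _ => by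
  refine (dist_triangle _ (ζ'.1 (ζ.projParam x + t)) _).trans (add_le_add (hK _) ?_)
  rw [ζ'.dist_eq, add_sub_add_right_eq_sub]

theorem dist_le_of_forall_fellow (h : ∀ T, Fellow K T x ζ ζ') (t : ℝ) :
    dist (ζ.1 t) (ζ'.1 t) ≤ K + |ζ.projParam x - ζ'.projParam x| := by
  have hdist := h _ (t - ζ.projParam x) le_rfl
  rw [add_sub_cancel] at hdist
  refine (dist_triangle _ _ _).trans (add_le_add hdist ?_)
  rw [ζ'.dist_eq, abs_sub_comm, show t - (ζ'.projParam x + (t - ζ.projParam x)) =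
    ζ.projParam x - ζ'.projParam x by ring]

theorem GeodLine.posEnd_eq_iff :
    ζ.posEnd = ζ'.posEnd ↔ ∃ K : ℝ, ∀ t : ℝ, 0 ≤ t → dist (ζ.1 t) (ζ'.1 t) ≤ K := by
  constructor
  · intro h
    obtain ⟨K, hK⟩ := Quotient.exact h
    exact ⟨K, fun t ht => hK ⟨t, ht⟩⟩
  · rintro ⟨K, hK⟩
    exact Quotient.sound ⟨K, fun t => hK t t.2⟩

theorem GeodLine.ends_eq_iff :
    (ζ.negEnd = ζ'.negEnd ∧ ζ.posEnd = ζ'.posEnd) ↔ ∃ K : ℝ, ∀ t, dist (ζ.1 t) (ζ'.1 t) ≤ K := by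
  rw [GeodLine.negEnd, GeodLine.negEnd, GeodLine.posEnd_eq_iff, GeodLine.posEnd_eq_iff]
  constructor
  · rintro ⟨⟨K, hK⟩, K', hK'⟩
    refine ⟨max K K', fun t => ?_⟩
    rcases le_total 0 t with ht | ht
    · exact (hK' t ht).trans (le_max_right _ _)
    · have hneg := hK (-t) (by linarith)
      rw [ζ.reverse_apply, ζ'.reverse_apply, neg_neg] at hneg
      exact hneg.trans (le_max_left _ _)
  · rintro ⟨K, hK⟩
    exact ⟨⟨K, fun t _ => hK _⟩, K, fun t _ => hK _⟩

end Metric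

variable [IsCAT0 X]

theorem exists_dist_eq_and_dist_eq_sub (a b : X) {r : ℝ} (hr : r ∈ Icc 0 (dist a b)) :
    ∃ y, dist a y = r ∧ dist y b = dist a b - r := by
  obtain ⟨c, hca, hcb, hc⟩ := IsCAT0.exists_geodesic a b
  have ha := hc 0 (left_mem_Icc.2 dist_nonneg) r hr
  have hb := hc r hr _ (right_mem_Icc.2 dist_nonneg)
  rw [hca, zero_sub, abs_neg, abs_of_nonneg hr.1] at ha
  rw [hcb, abs_sub_comm, abs_of_nonneg (sub_nonneg.2 hr.2)] at hb
  exact ⟨c r, ha, hb⟩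

section Contracting

variable {B : ℝ} {x : X}

-- The ball of radius `d(x, x₁) - 1` about `x`, where `x₁` is the projection of `x` to `ζ`, misses
-- `ζ` and contains a point at distance at most `6B + 3` from the projection of `x` to `ζ'`.
theorem GeodLine.IsContracting.dist_projParam_projParam_le (hB : 0 ≤ B) {ζ ζ' : GeodLine X}
    (h : ζ.IsContracting B) (hp : ζ.projParam x ∈ fellowSet B ζ ζ')
    (hp' : ζ'.projParam x ∈ fellowSet B ζ' ζ) :
    dist (ζ.1 (ζ.projParam x)) (ζ'.1 (ζ'.projParam x)) ≤ 13 * B + 5 := by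
  rw [mem_fellowSet] at hp hp'
  have hx := Metric.infDist_le_infDist_add_dist (s := range ζ'.1) (x := x)
    (y := ζ.1 (ζ.projParam x))
  rw [ζ'.infDist_range_eq x] at hx
  rw [ζ.infDist_range_eq] at hp'
  set x₁ := ζ.1 (ζ.projParam x)
  set x₂ := ζ'.1 (ζ'.projParam x)
  rcases lt_or_ge (dist x x₁) 1 with hlt | hge
  · linarith [dist_triangle_left x₁ x₂ x]
  obtain ⟨y, hxy, hyx₂⟩ := exists_dist_eq_and_dist_eq_sub x x₂
    ⟨le_min (sub_nonneg.2 hge) dist_nonneg, min_le_right (dist x x₁ - 1) _⟩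
  have hball : |ζ.projParam x - ζ.projParam y| ≤ B := by
    refine h.abs_projParam_sub_le_of_lt_infDist hB (p := x) (r := dist x x₁ - 1)
      (by rw [ζ.infDist_range_eq]; exact sub_one_lt _) (by rwa [dist_self, sub_nonneg]) ?_
    rw [dist_comm, hxy]
    exact min_le_left _ _
  have hy : dist y x₂ ≤ 6 * B + 3 := by
    rw [hyx₂]
    rcases min_choice (dist x x₁ - 1) (dist x x₂) with hmin | hmin <;> rw [hmin] <;> linarith
  have hproj := (ζ.abs_projParam_sub_projParam_le y x₂).trans hy
  have htri := dist_triangle_right x₁ x₂ (ζ.1 (ζ.projParam x₂))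
  rw [ζ.dist_eq] at htri
  linarith [abs_sub_le (ζ.projParam x) (ζ.projParam y) (ζ.projParam x₂)]

-- The projection to `ζ'` is 1-Lipschitz along `ζ`, so that it advances at unit speed up to the
-- defect `2K` it has over the whole interval.
theorem dist_le_of_forall_infDist_le {ζ ζ' : GeodLine X} {p p' T K M : ℝ}
    (hK : ∀ t, |t| ≤ T → Metric.infDist (ζ.1 (p + t)) (range ζ'.1) ≤ K)
    (hinc : 2 * T - 2 * K ≤ ζ'.projParam (ζ.1 (p + T)) - ζ'.projParam (ζ.1 (p - T)))
    (hM : |ζ'.projParam (ζ.1 p) - p'| ≤ M) {t : ℝ} (ht : |t| ≤ T) :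
    dist (ζ.1 (p + t)) (ζ'.1 (p' + t)) ≤ 3 * K + M := by
  have hT : |0| ≤ T := by simpa only [abs_zero] using (abs_nonneg t).trans ht
  have hspeed : ∀ s, |s| ≤ T →
      ζ'.projParam (ζ.1 (p + s)) ≤ ζ'.projParam (ζ.1 (p - T)) + (T + s) ∧
      ζ'.projParam (ζ.1 (p - T)) + (T + s) - 2 * K ≤ ζ'.projParam (ζ.1 (p + s)) := by
    intro s hs
    obtain ⟨hs₁, hs₂⟩ := abs_le.1 hs
    have hleft := (le_abs_self _).trans (ζ.abs_projParam_apply_sub_le ζ' (p + s) (p - T))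
    have hright := (le_abs_self _).trans (ζ.abs_projParam_apply_sub_le ζ' (p + T) (p + s))
    rw [abs_of_nonneg (by linarith)] at hleft hright
    constructor <;> linarith
  have hspeed₀ := hspeed 0 hT
  rw [add_zero, add_zero] at hspeed₀
  have hshift : |ζ'.projParam (ζ.1 (p + t)) - (ζ'.projParam (ζ.1 p) + t)| ≤ 2 * K :=
    abs_le.2 ⟨by linarith [hspeed t ht], by linarith [hspeed t ht]⟩
  have hclose := hK t ht
  rw [ζ'.infDist_range_eq] at hclose
  have htri := dist_triangle (ζ.1 (p + t)) (ζ'.1 (ζ'.projParam (ζ.1 (p + t)))) (ζ'.1 (p' + t))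
  rw [ζ'.dist_eq] at htri
  have habs := abs_sub_le (ζ'.projParam (ζ.1 (p + t))) (ζ'.projParam (ζ.1 p) + t) (p' + t)
  rw [add_sub_add_right_eq_sub] at habs
  linarith

variable {ζ₁ ζ₂ : GeodLine X} {K T : ℝ}

theorem fellow_of_le_tauLine (hB : 0 ≤ B) (h₁ : ζ₁.IsContracting B) (hT : 18 * B + 6 < T)
    (h : ENNReal.ofReal T ≤ tauLine B x ζ₁ ζ₂) : Fellow (37 * B + 13) T x ζ₁ ζ₂ := by
  have hT₀ : 0 < T := by linarith
  obtain ⟨⟨-, horient⟩, ⟨hl₁, hr₁⟩, hl₂, hr₂⟩ := (ofReal_le_tauLine_iff hT₀).1 h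
  have hmem : ∀ t, |t| ≤ T → ζ₁.projParam x + t ∈ fellowSet B ζ₁ ζ₂ := fun t ht =>
    (ordConnected_fellowSet B ζ₁ ζ₂).out hl₁ hr₁
      ⟨by linarith [neg_le_of_abs_le ht], by linarith [le_of_abs_le ht]⟩
  have hp₁ : ζ₁.projParam x ∈ fellowSet B ζ₁ ζ₂ := by
    simpa only [add_zero] using hmem 0 (abs_zero.trans_le hT₀.le)
  have hp₂ : ζ₂.projParam x ∈ fellowSet B ζ₂ ζ₁ :=
    (ordConnected_fellowSet B ζ₂ ζ₁).out hl₂ hr₂ ⟨by linarith, by linarith⟩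
  have hM := (ζ₂.abs_projParam_sub_projParam_le _ _).trans
    (h₁.dist_projParam_projParam_le hB hp₁ hp₂)
  rw [ζ₂.projParam_apply] at hM
  rw [coherentlyOriented_iff_projParam_lt hl₁ hr₁ (by linarith)] at horient
  have hinc := abs_sub_sub_le_of_mem_fellowSet hr₁ hl₁
  rw [abs_of_pos (sub_pos.2 horient), abs_of_pos (by linarith)] at hinc
  intro t ht
  linarith [dist_le_of_forall_infDist_le hmem (by linarith) hM ht]

theorem Fellow.add_mem_fellowSet (hB : 0 ≤ B) (h₂ : ζ₂.IsContracting B)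
    (h : Fellow K T x ζ₁ ζ₂) (hK : 0 ≤ K) {t : ℝ} (ht : |t| ≤ T - (3 * K + 2 * B + 1)) :
    ζ₁.projParam x + t ∈ fellowSet B ζ₁ ζ₂ := by
  have hT : 0 ≤ T := by linarith [abs_nonneg t]
  have hclose := fun s hs => (ζ₂.infDist_range_le _ _).trans (h s hs)
  exact h₂.infDist_le_of_mem_Icc hB (ζ₁.isGeodesicOn _)
    (hclose (-T) (by rw [abs_neg, abs_of_nonneg hT])) (hclose T (by rw [abs_of_nonneg hT]))
    ⟨by linarith [neg_le_of_abs_le ht], by linarith [le_of_abs_le ht]⟩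

theorem Fellow.coherentlyOriented (hB : 0 ≤ B) (h₂ : ζ₂.IsContracting B)
    (h : Fellow K T x ζ₁ ζ₂) (hK : 0 ≤ K) (hT : 4 * K + 20 * B + 7 < T) :
    CoherentlyOriented B ζ₂ ζ₁ := by
  set S := T - (3 * K + 2 * B + 1) with hS
  have hS₀ : 0 < S := by linarith [hS]
  have habs : |S| = S := abs_of_pos hS₀
  have habs' : |-S| = S := by rw [abs_neg, habs]
  rw [coherentlyOriented_iff_projParam_lt (h.add_mem_fellowSet hB h₂ hK habs'.le)
    (h.add_mem_fellowSet hB h₂ hK habs.le) (by linarith)]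
  have hproj : ∀ s, |s| = S →
      |ζ₂.projParam (ζ₁.1 (ζ₁.projParam x + s)) - (ζ₂.projParam x + s)| ≤ K := fun s hs => by
    have hdist := (ζ₂.abs_projParam_sub_projParam_le _ _).trans (h s (by linarith))
    rwa [ζ₂.projParam_apply] at hdist
  linarith [le_of_abs_le (hproj _ habs'), neg_le_of_abs_le (hproj _ habs)]

theorem Fellow.le_tauLine (hB : 0 ≤ B) (h₁ : ζ₁.IsContracting B) (h₂ : ζ₂.IsContracting B)
    (h : Fellow K T x ζ₁ ζ₂) (hK : 0 ≤ K) :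
    ENNReal.ofReal (T - (4 * K + 20 * B + 7)) ≤ tauLine B x ζ₁ ζ₂ := by
  rcases le_or_gt (T - (4 * K + 20 * B + 7)) 0 with hle | hlt
  · rw [ENNReal.ofReal_of_nonpos hle]
    exact zero_le
  have hle : |T - (4 * K + 20 * B + 7)| ≤ T - (3 * K + 2 * B + 1) := by
    rw [abs_of_pos hlt]
    linarith
  have hle' : |-(T - (4 * K + 20 * B + 7))| ≤ T - (3 * K + 2 * B + 1) := by rwa [abs_neg]
  rw [ofReal_le_tauLine_iff hlt]
  exact ⟨⟨h.symm.coherentlyOriented hB h₁ hK (by linarith),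
    h.coherentlyOriented hB h₂ hK (by linarith)⟩,
    ⟨h.add_mem_fellowSet hB h₂ hK hle', h.add_mem_fellowSet hB h₂ hK hle⟩,
    ⟨h.symm.add_mem_fellowSet hB h₁ hK hle', h.symm.add_mem_fellowSet hB h₁ hK hle⟩⟩

variable {α β : VisualBoundary X × VisualBoundary X}

-- Two lines with the same endpoints are at finite distance, hence `τ_B` is infinite on them.
theorem fellow_of_contractingJoins (hB : 0 ≤ B) (h₁ : ζ₁.ContractingJoins B α)
    (h₂ : ζ₂.ContractingJoins B α) (x : X) (T : ℝ) : Fellow (37 * B + 13) T x ζ₁ ζ₂ := by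
  obtain ⟨K, hK⟩ := GeodLine.ends_eq_iff.1 ⟨h₁.2.1.trans h₂.2.1.symm, h₁.2.2.trans h₂.2.2.symm⟩
  have hK₀ : 0 ≤ K := dist_nonneg.trans (hK 0)
  have hfellow := fellow_of_forall_dist_le hK x
  set K' := K + |ζ₁.projParam x - ζ₂.projParam x|
  set S := max T (18 * B + 7)
  have hle := (hfellow (S + (4 * K' + 20 * B + 7))).le_tauLine hB h₁.1 h₂.1 (by positivity)
  rw [add_sub_cancel_right] at hle
  have hS : 18 * B + 6 < S := by linarith [le_max_right T (18 * B + 7)]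
  exact (fellow_of_le_tauLine hB h₁.1 hS hle).mono (le_max_left _ _)

theorem Fellow.le_tau (hB : 0 ≤ B) (h₁ : ζ₁.ContractingJoins B α)
    (h₂ : ζ₂.ContractingJoins B β) (h : Fellow K T x ζ₁ ζ₂) (hK : 0 ≤ K) :
    ENNReal.ofReal (T - (4 * K + 316 * B + 111)) ≤ tau B x α β := by
  refine le_iInf₂ fun ζ₁' h₁' => le_iInf₂ fun ζ₂' h₂' => ?_
  have hle := (((fellow_of_contractingJoins hB h₁' h₁ x T).trans h).trans
    (fellow_of_contractingJoins hB h₂ h₂' x T)).le_tauLine hB h₁'.1 h₂'.1 (by linarith)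
  exact (ENNReal.ofReal_le_ofReal (by linarith)).trans hle

theorem fellow_of_le_tau (hB : 0 ≤ B) (h₁ : ζ₁.ContractingJoins B α)
    (h₂ : ζ₂.ContractingJoins B β) (hT : 18 * B + 6 < T) (h : ENNReal.ofReal T ≤ tau B x α β) :
    Fellow (37 * B + 13) T x ζ₁ ζ₂ :=
  fellow_of_le_tauLine hB h₁.1 hT (h.trans (iInf₂_le_of_le ζ₁ h₁ (iInf₂_le ζ₂ h₂)))

end Contracting

variable {B : ℝ} {α β η : ContractingPairs X B}

theorem tau_ne_top (hB : 0 ≤ B) (x : X) (hne : α ≠ β) : tau B x α.1 β.1 ≠ ⊤ := by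
  intro htop
  obtain ⟨ζ₁, h₁⟩ := α.2
  obtain ⟨ζ₂, h₂⟩ := β.2
  have hfellow : ∀ T, Fellow (37 * B + 13) T x ζ₁ ζ₂ := fun T =>
    (fellow_of_le_tau hB h₁ h₂ (T := max T (18 * B + 7)) (by linarith [le_max_right T (18 * B + 7)])
      (htop ▸ le_top)).mono (le_max_left _ _)
  obtain ⟨hneg, hpos⟩ := GeodLine.ends_eq_iff.2 ⟨_, dist_le_of_forall_fellow hfellow⟩
  rw [h₁.2.1, h₂.2.1] at hneg
  rw [h₁.2.2, h₂.2.2] at hpos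
  exact hne (Subtype.ext (Prod.ext hneg hpos))

theorem le_tau_of_le_tau (hB : 0 ≤ B) {x : X} {T : ℝ} (h : ENNReal.ofReal T ≤ tau B x α.1 β.1)
    (h' : ENNReal.ofReal T ≤ tau B x β.1 η.1) :
    ENNReal.ofReal (T - 612 * (B + 1)) ≤ tau B x α.1 η.1 := by
  rcases le_or_gt T (18 * B + 6) with hle | hlt
  · rw [ENNReal.ofReal_of_nonpos (by linarith)]
    exact zero_le
  obtain ⟨ζ₁, h₁⟩ := α.2
  obtain ⟨ζ₂, h₂⟩ := β.2
  obtain ⟨ζ₃, h₃⟩ := η.2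
  have hfellow := (fellow_of_le_tau hB h₁ h₂ hlt h).trans (fellow_of_le_tau hB h₂ h₃ hlt h')
  exact (ENNReal.ofReal_le_ofReal (by linarith)).trans (hfellow.le_tau hB h₁ h₃ (by linarith))

end

section

/-! ### Rays and the cone topology -/

theorem apply_le_of_convexOn_Ici {f : ℝ → ℝ} (hf : ConvexOn ℝ (Ici 0) f) {s t : ℝ} (ht : 0 ≤ t)
    (hs : 0 < s) (hts : t ≤ s) : f t ≤ (1 - t / s) * f 0 + t / s * f s := by
  have hconv := hf.2 self_mem_Ici (mem_Ici.2 hs.le) (sub_nonneg.2 ((div_le_one hs).2 hts))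
    (div_nonneg ht hs.le) (sub_add_cancel 1 _)
  simpa only [smul_eq_mul, mul_zero, zero_add, div_mul_cancel₀ _ hs.ne'] using hconv

theorem le_apply_zero_of_convexOn_of_forall_le {f : ℝ → ℝ} (hf : ConvexOn ℝ (Ici 0) f) {K : ℝ}
    (hK : ∀ t, 0 ≤ t → f t ≤ K) {t : ℝ} (ht : 0 ≤ t) : f t ≤ f 0 := by
  have hdiv : Tendsto (fun s => t / s) atTop (𝓝 0) := tendsto_const_nhds.div_atTop tendsto_id
  have hlim := ((hdiv.const_sub 1).mul_const (f 0)).add (hdiv.mul_const K)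
  rw [sub_zero, one_mul, zero_mul, add_zero] at hlim
  refine ge_of_tendsto hlim ?_
  filter_upwards [eventually_ge_atTop t, eventually_gt_atTop 0] with s hts hs
  exact (apply_le_of_convexOn_Ici hf ht hs hts).trans <| add_le_add_right
    (mul_le_mul_of_nonneg_left (hK s hs.le) (div_nonneg ht hs.le)) _

theorem exists_tendsto_nhds_of_eventually_dist_le {E ι : Type*} [PseudoMetricSpace E]
    [ProperSpace E] {F : Ultrafilter ι} {f : ι → E} {o : E} {R : ℝ}
    (h : ∀ᶠ i in F, dist (f i) o ≤ R) : ∃ z, Tendsto f F (𝓝 z) := by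
  obtain ⟨z, -, hz⟩ := (isCompact_closedBall o R).ultrafilter_le_nhds (F.map f)
    (le_principal_iff.2 h)
  exact ⟨z, hz⟩

variable {X : Type u} [MetricSpace X]

theorem exists_isometry_tendsto [ProperSpace X] {E ι : Type*} [PseudoMetricSpace E]
    {F : Ultrafilter ι} {f : ι → E → X} (hf : ∀ s t, ∀ᶠ i in F, dist (f i s) (f i t) = dist s t)
    {e : E} {o : X} {R : ℝ} (he : ∀ᶠ i in F, dist (f i e) o ≤ R) :
    ∃ g : E → X, Isometry g ∧ ∀ s, Tendsto (fun i => f i s) F (𝓝 (g s)) := by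
  have hlim : ∀ s, ∃ z, Tendsto (fun i => f i s) F (𝓝 z) := fun s =>
    exists_tendsto_nhds_of_eventually_dist_le (o := o) (R := dist s e + R) <| by
      filter_upwards [hf s e, he] with i hdist hi
      exact (dist_triangle _ (f i e) _).trans (add_le_add hdist.le hi)
  choose g hg using hlim
  exact ⟨g, Isometry.of_dist_eq fun s t => tendsto_nhds_unique ((hg s).dist (hg t))
    (tendsto_const_nhds.congr' ((hf s t).mono fun _ h => h.symm)), hg⟩

/-- A ray as a curve with a real parameter, so that it can be compared with lines and segments; the
values at negative parameters are irrelevant. -/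
def GeodRay.curve (r : GeodRay X) (t : ℝ) : X := r.1 t.toNNReal

theorem GeodRay.curve_coe (r : GeodRay X) (t : ℝ≥0) : r.curve t = r.1 t := by
  rw [GeodRay.curve, Real.toNNReal_coe]

theorem GeodRay.curve_zero (r : GeodRay X) : r.curve 0 = r.1 0 := r.curve_coe 0

theorem GeodRay.isGeodesicOn_curve (r : GeodRay X) : IsGeodesicOn r.curve (Ici 0) :=
  fun s hs t ht => by
    rw [GeodRay.curve, GeodRay.curve, r.2.dist_eq, NNReal.dist_eq, Real.coe_toNNReal s hs,
      Real.coe_toNNReal t ht]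

theorem GeodRay.dist_curve_zero (r : GeodRay X) {t : ℝ} (ht : 0 ≤ t) :
    dist (r.curve t) (r.1 0) = t := by
  rw [← r.curve_zero, r.isGeodesicOn_curve t ht 0 self_mem_Ici, sub_zero, abs_of_nonneg ht]

theorem GeodRay.endpoint_eq_iff {r r' : GeodRay X} :
    r.endpoint = r'.endpoint ↔ ∃ K : ℝ, ∀ t : ℝ, 0 ≤ t → dist (r.curve t) (r'.curve t) ≤ K := by
  constructor
  · intro h
    obtain ⟨K, hK⟩ := Quotient.exact h
    exact ⟨K, fun t _ => hK _⟩
  · rintro ⟨K, hK⟩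
    refine Quotient.sound ⟨K, fun t => ?_⟩
    rw [← r.curve_coe, ← r'.curve_coe]
    exact hK t t.2

theorem GeodRay.exists_dist_le_of_endpoint_eq_posEnd {r : GeodRay X} {ζ : GeodLine X}
    (h : r.endpoint = ζ.posEnd) : ∃ K : ℝ, ∀ t : ℝ, 0 ≤ t → dist (r.curve t) (ζ.1 t) ≤ K := by
  obtain ⟨K, hK⟩ := GeodRay.endpoint_eq_iff.1 h
  refine ⟨K, fun t ht => (Eq.le ?_).trans (hK t ht)⟩
  exact congrArg (fun s => dist (r.curve t) (ζ.1 s)) (Real.coe_toNNReal t ht).symm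

theorem GeodRay.setOf_dist_curve_lt_mem_nhds (r : GeodRay X) (t : ℝ) {ε : ℝ} (hε : 0 < ε) :
    {r' : GeodRay X | dist (r.curve t) (r'.curve t) < ε} ∈ 𝓝 r := by
  have hcont : Continuous fun r' : GeodRay X => r'.curve t :=
    (continuous_eval_const (F := C(ℝ≥0, X)) t.toNNReal).comp continuous_subtype_val
  exact (continuous_const.dist hcont).continuousAt.eventually_lt continuousAt_const
    (by rwa [dist_self])

section CAT0

variable [IsCAT0 X]

theorem GeodRay.dist_le_of_endpoint_eq_posEnd {r : GeodRay X} {ζ : GeodLine X}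
    (h : r.endpoint = ζ.posEnd) (p : ℝ) {t : ℝ} (ht : 0 ≤ t) :
    dist (r.curve t) (ζ.1 (p + t)) ≤ dist (r.1 0) (ζ.1 p) := by
  obtain ⟨K, hK⟩ := GeodRay.exists_dist_le_of_endpoint_eq_posEnd h
  have hconv := r.isGeodesicOn_curve.convexOn_dist (convex_Ici 0) (ζ.isGeodesicOn_const_add p _)
  have hle := le_apply_zero_of_convexOn_of_forall_le hconv (K := K + |p|) (fun t ht => ?_) ht
  · rwa [r.curve_zero, add_zero] at hle
  · refine (dist_triangle _ (ζ.1 t) _).trans (add_le_add (hK t ht) ?_)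
    rw [ζ.dist_eq, sub_add_cancel_right, abs_neg]

theorem GeodRay.mul_dist_le_mul_dist {r r' : GeodRay X} (h : r.1 0 = r'.1 0) {t R : ℝ}
    (ht : 0 ≤ t) (hR : 0 < R) (htR : t ≤ R) :
    R * dist (r.curve t) (r'.curve t) ≤ t * dist (r.curve R) (r'.curve R) := by
  have hconv := apply_le_of_convexOn_Ici
    (r.isGeodesicOn_curve.convexOn_dist (convex_Ici 0) r'.isGeodesicOn_curve) ht hR htR
  rw [r.curve_zero, r'.curve_zero, h, dist_self, mul_zero, zero_add, div_mul_eq_mul_div,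
    le_div_iff₀ hR] at hconv
  linarith

theorem GeodRay.eq_of_endpoint_eq {r r' : GeodRay X} (h : r.1 0 = r'.1 0)
    (hend : r.endpoint = r'.endpoint) : r = r' := by
  obtain ⟨K, hK⟩ := GeodRay.endpoint_eq_iff.1 hend
  have hconv := r.isGeodesicOn_curve.convexOn_dist (convex_Ici 0) r'.isGeodesicOn_curve
  refine Subtype.ext (ContinuousMap.ext fun t => dist_le_zero.1 ?_)
  have hle := le_apply_zero_of_convexOn_of_forall_le hconv hK t.2
  rwa [r.curve_zero, r'.curve_zero, h, dist_self, NNReal.val_eq_coe, r.curve_coe,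
    r'.curve_coe] at hle

theorem IsGeodesicOn.dist_le_of_apply_eq_apply {c c' : ℝ → X} {l l' : ℝ}
    (hc : IsGeodesicOn c (Icc 0 l)) (hc' : IsGeodesicOn c' (Icc 0 l')) (h : c l = c' l') {t : ℝ}
    (ht : t ∈ Icc 0 (min l l')) : dist (c t) (c' t) ≤ dist (c 0) (c' 0) := by
  wlog hll' : l ≤ l' generalizing c c' l l'
  · rw [dist_comm, dist_comm (c 0)]
    exact this hc' hc h.symm (min_comm l l' ▸ ht) (le_of_not_ge hll')
  rw [min_eq_left hll'] at ht
  have hl : 0 ≤ l := ht.1.trans ht.2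
  have hconv := (hc.convexOn_dist (convex_Icc 0 l)
    (hc'.mono (Icc_subset_Icc_right hll'))).le_max_of_mem_Icc (left_mem_Icc.2 hl)
    (right_mem_Icc.2 hl) ht
  refine hconv.trans (max_le le_rfl ?_)
  have hlen := hc 0 (left_mem_Icc.2 hl) l (right_mem_Icc.2 hl)
  have hlen' := hc' 0 (left_mem_Icc.2 (hl.trans hll')) l' (right_mem_Icc.2 (hl.trans hll'))
  rw [zero_sub, abs_neg, abs_of_nonneg hl] at hlen
  rw [zero_sub, abs_neg, abs_of_nonneg (hl.trans hll')] at hlen'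
  rw [h, hc' l' (right_mem_Icc.2 (hl.trans hll')) l ⟨hl, hll'⟩, abs_of_nonneg (sub_nonneg.2 hll')]
  have htri := dist_triangle_left (c' 0) (c l) (c 0)
  rw [h] at htri hlen
  linarith

variable [ProperSpace X]

-- The segments from `o` to the points of a ray subconverge to a ray asymptotic to it.
theorem exists_geodRay_endpoint_eq (o : X) (ξ : VisualBoundary X) :
    ∃ r : GeodRay X, r.1 0 = o ∧ r.endpoint = ξ := by
  obtain ⟨r, rfl⟩ := Quotient.exists_rep ξ
  choose c hco hcr hc using fun n : ℕ => IsCAT0.exists_geodesic o (r.curve n)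
  have hlen : ∀ t : ℝ, ∀ᶠ n : ℕ in hyperfilter ℕ, t ≤ dist o (r.curve n) ∧ t ≤ n := fun t => by
    refine Nat.hyperfilter_le_atTop ?_
    filter_upwards [tendsto_natCast_atTop_atTop.eventually_ge_atTop (t + dist o (r.1 0))] with n hn
    have htri := dist_triangle_left (r.curve n) (r.1 0) o
    rw [r.dist_curve_zero n.cast_nonneg] at htri
    exact ⟨by linarith, by linarith [dist_nonneg (x := o) (y := r.1 0)]⟩
  obtain ⟨f, hiso, hf⟩ := exists_isometry_tendsto (F := hyperfilter ℕ) (e := (0 : ℝ≥0)) (o := o)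
    (R := 0) (E := ℝ≥0) (f := fun n (t : ℝ≥0) => c n t) (fun s t => by
      filter_upwards [hlen s, hlen t] with n hs ht
      rw [hc n s ⟨s.2, hs.1⟩ t ⟨t.2, ht.1⟩, NNReal.dist_eq])
    (Eventually.of_forall fun n => by rw [NNReal.coe_zero, hco, dist_self])
  refine ⟨⟨⟨f, hiso.continuous⟩, hiso⟩, ?_, Quotient.sound ⟨dist o (r.1 0), fun t => ?_⟩⟩
  · refine tendsto_nhds_unique (hf 0) (tendsto_const_nhds.congr fun n => ?_)
    rw [NNReal.coe_zero, hco]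
  · refine le_of_tendsto ((hf t).dist tendsto_const_nhds) ?_
    filter_upwards [hlen t] with n hn
    have hle := IsGeodesicOn.dist_le_of_apply_eq_apply (hc n)
      (r.isGeodesicOn_curve.mono Icc_subset_Ici_self) (hcr n) ⟨t.2, le_min hn.1 hn.2⟩
    rwa [hco, r.curve_zero, NNReal.val_eq_coe, r.curve_coe] at hle

/-- The bijection between the rays issuing from `o` and the points of the boundary that defines the
topology of the boundary. -/
noncomputable def rayEquiv (o : X) : {r : GeodRay X // r.1 0 = o} ≃ VisualBoundary X :=
  Equiv.ofBijective (fun r => GeodRay.endpoint r.1)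
    ⟨fun r r' h => Subtype.ext (GeodRay.eq_of_endpoint_eq (r.2.trans r'.2.symm) h), fun ξ =>
      let ⟨r, h, h'⟩ := exists_geodRay_endpoint_eq o ξ
      ⟨⟨r, h⟩, h'⟩⟩

/-- The ray from `o` to the point `ξ` of the boundary. -/
noncomputable def rayTo (o : X) (ξ : VisualBoundary X) : GeodRay X := ((rayEquiv o).symm ξ).1

theorem rayTo_zero (o : X) (ξ : VisualBoundary X) : (rayTo o ξ).1 0 = o :=
  ((rayEquiv o).symm ξ).2

theorem endpoint_rayTo (o : X) (ξ : VisualBoundary X) : (rayTo o ξ).endpoint = ξ :=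
  (rayEquiv o).apply_symm_apply ξ

theorem coneTopology_eq_induced (o : X) :
    coneTopology o = TopologicalSpace.induced (rayTo o) inferInstance := by
  have hcoind : coneTopology o = TopologicalSpace.coinduced (rayEquiv o) inferInstance := rfl
  rw [hcoind, ← Equiv.induced_symm, show rayTo o = Subtype.val ∘ (rayEquiv o).symm from rfl,
    ← induced_compose]
  rfl

end CAT0

theorem GeodRay.tendsto_nhds_of_forall_dist_lt [IsCAT0 X] {r : GeodRay X} {ι : Type*}
    {F : Filter ι} {s : ι → GeodRay X} (hs : ∀ i, r.1 0 = (s i).1 0)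
    (h : ∀ R, 0 < R → ∀ ε, 0 < ε → ∀ᶠ i in F, dist (r.curve R) ((s i).curve R) < ε) :
    Tendsto s F (𝓝 r) := by
  rw [tendsto_subtype_rng, ContinuousMap.tendsto_iff_forall_isCompact_tendstoUniformlyOn]
  intro K hK
  rw [Metric.tendstoUniformlyOn_iff]
  intro ε hε
  obtain ⟨R, hR⟩ := hK.bddAbove
  have hR' : (0 : ℝ) < R + 1 := by positivity
  filter_upwards [h (R + 1) hR' ε hε] with i hi t ht
  have htR : (t : ℝ) ≤ R + 1 := by linarith [NNReal.coe_le_coe.2 (hR ht)]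
  have hmul := GeodRay.mul_dist_le_mul_dist (hs i) t.2 hR' htR
  rw [NNReal.val_eq_coe, r.curve_coe, (s i).curve_coe] at hmul
  exact (le_of_mul_le_mul_left
    (hmul.trans (mul_le_mul_of_nonneg_right htR dist_nonneg)) hR').trans_lt hi

end

section

variable {X : Type u} [MetricSpace X]

/-! ### Convergence of endpoints and fellow travelling -/

theorem GeodLine.IsContracting.reverse {B : ℝ} {γ : GeodLine X} (h : γ.IsContracting B) :
    γ.reverse.IsContracting B :=
  (GeodLine.ContractingJoins.reverse (α := (γ.negEnd, γ.posEnd)) ⟨h, rfl, rfl⟩).1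

variable [IsCAT0 X]

theorem GeodLine.abs_projParam_sub_le_dist (γ : GeodLine X) (p : X) (t : ℝ) :
    |γ.projParam p - t| ≤ dist p (γ.1 t) := by
  simpa only [γ.projParam_apply] using γ.abs_projParam_sub_projParam_le p (γ.1 t)

section Ray

variable {γ : GeodLine X} {ρ : GeodRay X} {M : ℝ}

theorem GeodRay.le_infDist_add_abs_projParam (hM : dist (ρ.1 0) (γ.1 0) ≤ M) {t : ℝ}
    (ht : 0 ≤ t) :
    t ≤ Metric.infDist (ρ.curve t) (range γ.1) + |γ.projParam (ρ.curve t)| + 2 * M := by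
  have hdist := γ.dist_le_infDist_add_abs_projParam_sub (ρ.curve t) (ρ.1 0)
  have hproj := (γ.abs_projParam_sub_le_dist (ρ.1 0) 0).trans hM
  rw [ρ.dist_curve_zero ht] at hdist
  rw [sub_zero] at hproj
  linarith [abs_sub (γ.projParam (ρ.curve t)) (γ.projParam (ρ.1 0)),
    (γ.infDist_range_le (ρ.1 0) 0).trans hM]

-- The projection of the ray cannot pass through `γ 0`, because the ray leaves the neighbourhood of
-- `γ 0` within the time `K + 2 * M`.
theorem GeodRay.sub_le_projParam_of_infDist_le (hM : dist (ρ.1 0) (γ.1 0) ≤ M) {K R t : ℝ}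
    (hR₀ : 0 ≤ R) (hKR : K + 2 * M < R) (ht : R ≤ t)
    (hproj : 0 ≤ γ.projParam (ρ.curve R))
    (hR : Metric.infDist (ρ.curve R) (range γ.1) ≤ K)
    (hclose : Metric.infDist (ρ.curve t) (range γ.1) ≤ K) :
    t - K - 2 * M ≤ γ.projParam (ρ.curve t) := by
  have hgeod : IsGeodesicOn ρ.curve (Icc R t) :=
    ρ.isGeodesicOn_curve.mono fun s hs => hR₀.trans hs.1
  have hpos : 0 ≤ γ.projParam (ρ.curve t) := by
    by_contra! hneg
    obtain ⟨s, hs, hzero : γ.projParam (ρ.curve s) = 0⟩ := intermediate_value_Icc' ht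
      (γ.continuous_projParam.comp_continuousOn hgeod.continuousOn) ⟨hneg.le, hproj⟩
    have hsK := ((hgeod.convexOn_infDist_range (convex_Icc R t) γ).le_max_of_mem_Icc
      (left_mem_Icc.2 ht) (right_mem_Icc.2 ht) hs).trans (max_le hR hclose)
    have hle := GeodRay.le_infDist_add_abs_projParam hM (hR₀.trans hs.1)
    rw [hzero, abs_zero] at hle
    linarith [hs.1]
  have hle := GeodRay.le_infDist_add_abs_projParam hM (hR₀.trans ht)
  rw [abs_of_nonneg hpos] at hle
  linarith

variable {B R : ℝ}

theorem GeodLine.IsContracting.le_projParam_curve (hB : 0 ≤ B) (h : γ.IsContracting B)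
    (hM : dist (ρ.1 0) (γ.1 0) ≤ M) (hR : dist (ρ.curve R) (γ.1 R) ≤ M + 1)
    (hMR : 3 * M + 12 * B + 3 ≤ R) {t : ℝ} (ht : R ≤ t) :
    R - 12 * B - 2 - 3 * M ≤ γ.projParam (ρ.curve t) := by
  have hM₀ : 0 ≤ M := dist_nonneg.trans hM
  have hR₀ : 0 ≤ R := by linarith
  have hgeod : IsGeodesicOn ρ.curve (Icc R t) :=
    ρ.isGeodesicOn_curve.mono fun s hs => hR₀.trans hs.1
  have hprojR := (abs_le.1 ((γ.abs_projParam_sub_le_dist (ρ.curve R) R).trans hR)).1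
  by_contra! hlt
  have hfar : 6 * B < |γ.projParam (ρ.curve R) - γ.projParam (ρ.curve t)| :=
    lt_of_lt_of_le (by linarith) (le_abs_self _)
  obtain ⟨s, hs, hclose, hproj⟩ := h.exists_last_infDist_le hB hgeod
    (h.exists_infDist_le_of_lt_abs_projParam_sub hB ht hgeod hfar)
  have hle := GeodRay.sub_le_projParam_of_infDist_le hM (K := M + 6 * B + 1) hR₀ (by linarith)
    hs.1 (by linarith) ((γ.infDist_range_le _ R).trans (by linarith)) (hclose.trans (by linarith))
  linarith [(abs_le.1 hproj).2, hs.1]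

theorem GeodLine.IsContracting.exists_le_projParam (hB : 0 ≤ B) {ζ : GeodLine X}
    (h : γ.IsContracting B) (hM : dist (ρ.1 0) (γ.1 0) ≤ M)
    (hR : dist (ρ.curve R) (γ.1 R) ≤ M + 1) (hMR : 3 * M + 12 * B + 3 ≤ R)
    (hρ : ρ.endpoint = ζ.posEnd) :
    ∃ u, 0 ≤ u ∧ R - 13 * B - 2 - 3 * M ≤ γ.projParam (ζ.1 u) := by
  have hM₀ : 0 ≤ M := dist_nonneg.trans hM
  have hR₀ : 0 ≤ R := by linarith
  obtain ⟨D, hD⟩ := GeodRay.exists_dist_le_of_endpoint_eq_posEnd hρ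
  have hD₀ : 0 ≤ D := dist_nonneg.trans (hD 0 le_rfl)
  by_cases hcase : ∃ t, R ≤ t ∧ D < Metric.infDist (ρ.curve t) (range γ.1)
  · obtain ⟨t, ht, hlt⟩ := hcase
    have hproj := h.abs_projParam_sub_le_of_lt_infDist hB hlt (y := ρ.curve t)
      ((dist_self _).trans_le hD₀) ((dist_comm _ _).trans_le (hD t (hR₀.trans ht)))
    exact ⟨t, hR₀.trans ht, by
      linarith [(abs_le.1 hproj).2, h.le_projParam_curve hB hM hR hMR ht]⟩
  · push Not at hcase
    obtain ⟨t, ht⟩ : ∃ t, t = R + 2 * D + 2 * M := ⟨_, rfl⟩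
    have hRt : R ≤ t := by linarith
    have hproj := h.le_projParam_curve hB hM hR hMR hRt
    have hle := GeodRay.le_infDist_add_abs_projParam hM (hR₀.trans hRt)
    rw [abs_of_nonneg (by linarith : 0 ≤ γ.projParam (ρ.curve t))] at hle
    have hζ := (γ.abs_projParam_sub_projParam_le _ _).trans (hD t (hR₀.trans hRt))
    exact ⟨t, hR₀.trans hRt, by linarith [(abs_le.1 hζ).2, hcase t hRt]⟩

end Ray

section Line

variable {B : ℝ} {γ ζ : GeodLine X} {u₀ u₁ S : ℝ}

theorem sub_sub_le_projParam_sub_of_le_of_le (h₀ : u₀ ∈ fellowSet B ζ γ) (h₁ : u₁ ∈ fellowSet B ζ γ)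
    (hproj : γ.projParam (ζ.1 u₀) ≤ γ.projParam (ζ.1 u₁)) {s t : ℝ} (hs : u₀ ≤ s) (ht : t ≤ u₁) :
    t - s - 2 * (6 * B + 2) ≤ γ.projParam (ζ.1 t) - γ.projParam (ζ.1 s) := by
  have hinc := abs_sub_sub_le_of_mem_fellowSet h₁ h₀
  rw [abs_of_nonneg (sub_nonneg.2 hproj)] at hinc
  have hleft := (le_abs_self _).trans (ζ.abs_projParam_apply_sub_le γ s u₀)
  have hright := (le_abs_self _).trans (ζ.abs_projParam_apply_sub_le γ u₁ t)
  rw [abs_of_nonneg (sub_nonneg.2 hs)] at hleft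
  rw [abs_of_nonneg (sub_nonneg.2 ht)] at hright
  linarith [le_abs_self (u₁ - u₀)]

theorem fellow_of_mem_fellowSet (h₀ : u₀ ∈ fellowSet B ζ γ) (h₁ : u₁ ∈ fellowSet B ζ γ)
    (hu : u₀ ≤ u₁) (hu₀ : γ.projParam (ζ.1 u₀) ≤ -S) (hu₁ : S ≤ γ.projParam (ζ.1 u₁)) (x : X) :
    Fellow (24 * B + 8 + dist x (γ.1 0)) (S - (6 * B + 2 + dist x (γ.1 0))) x ζ γ := by
  intro t ht
  obtain ⟨T, hT⟩ : ∃ T, T = S - (6 * B + 2 + dist x (γ.1 0)) := ⟨_, rfl⟩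
  rw [← hT] at ht
  have hT₀ : 0 ≤ T := (abs_nonneg t).trans ht
  have hord := (ordConnected_fellowSet B ζ γ).out h₀ h₁
  have hlip : ∀ u v, γ.projParam (ζ.1 u) - γ.projParam (ζ.1 v) ≤ |u - v| := fun u v =>
    (le_abs_self _).trans (ζ.abs_projParam_apply_sub_le γ u v)
  have hB : 0 ≤ 6 * B + 2 := Metric.infDist_nonneg.trans (mem_fellowSet.1 h₀)
  have hS : 0 ≤ S := by linarith [dist_nonneg (x := x) (y := γ.1 0)]
  obtain ⟨w, hw, hzero : γ.projParam (ζ.1 w) = 0⟩ := intermediate_value_Icc hu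
    (γ.continuous_projParam.comp ζ.2.continuous).continuousOn
    ⟨hu₀.trans (neg_nonpos.2 hS), hS.trans hu₁⟩
  have hwclose := mem_fellowSet.1 (hord hw)
  rw [γ.infDist_range_eq, hzero] at hwclose
  have hxw : dist x (ζ.1 w) ≤ 6 * B + 2 + dist x (γ.1 0) := by
    linarith [dist_triangle_right x (ζ.1 w) (γ.1 0)]
  have hp := abs_le.1 ((ζ.abs_projParam_sub_le_dist x w).trans hxw)
  have hleft : u₀ ≤ ζ.projParam x - T := by
    have := hlip w u₀
    rw [hzero, abs_of_nonneg (sub_nonneg.2 hw.1)] at this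
    linarith
  have hright : ζ.projParam x + T ≤ u₁ := by
    have := hlip u₁ w
    rw [hzero, abs_of_nonneg (sub_nonneg.2 hw.2)] at this
    linarith
  have hinc := sub_sub_le_projParam_sub_of_le_of_le h₀ h₁ (by linarith) hleft hright
  have hproj : |γ.projParam (ζ.1 (ζ.projParam x)) - γ.projParam x| ≤
      6 * B + 2 + dist x (γ.1 0) :=
    (γ.abs_projParam_sub_projParam_le _ _).trans
      ((dist_comm _ _).trans_le ((ζ.dist_projParam_le x w).trans hxw))
  refine (dist_le_of_forall_infDist_le (T := T) (fun s hs => hord ⟨?_, ?_⟩) ?_ hproj ht).trans ?_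
  · linarith [(abs_le.1 hs).1]
  · linarith [(abs_le.1 hs).2]
  · linarith
  · linarith

theorem GeodLine.IsContracting.fellow_of_projParam_le (hB : 0 ≤ B) (h : γ.IsContracting B)
    (hu : u₀ ≤ u₁) (hS : 6 * B < S) (hu₀ : γ.projParam (ζ.1 u₀) ≤ -S)
    (hu₁ : S ≤ γ.projParam (ζ.1 u₁)) (x : X) :
    Fellow (24 * B + 8 + dist x (γ.1 0)) (S - 6 * B - (6 * B + 2 + dist x (γ.1 0))) x ζ γ := by
  have hfar : 6 * B < |γ.projParam (ζ.1 u₀) - γ.projParam (ζ.1 u₁)| := by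
    rw [abs_sub_comm]
    exact lt_of_lt_of_le (by linarith) (le_abs_self _)
  obtain ⟨v₀, hv₀, hclose₀, hproj₀⟩ := h.exists_first_infDist_le hB (ζ.isGeodesicOn (Icc u₀ u₁))
    (h.exists_infDist_le_of_lt_abs_projParam_sub hB hu (ζ.isGeodesicOn _) hfar)
  obtain ⟨v₁, hv₁, hclose₁, hproj₁⟩ := h.exists_last_infDist_le hB (ζ.isGeodesicOn (Icc v₀ u₁))
    ⟨v₀, left_mem_Icc.2 hv₀.2, hclose₀⟩
  exact fellow_of_mem_fellowSet (mem_fellowSet.2 (hclose₀.trans (by linarith)))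
    (mem_fellowSet.2 (hclose₁.trans (by linarith))) hv₁.1
    (by linarith [(abs_le.1 hproj₀).1]) (by linarith [(abs_le.1 hproj₁).1]) x

end Line

variable [ProperSpace X]

theorem GeodLine.dist_curve_rayTo_le {o : X} {ξ : VisualBoundary X} {ζ : GeodLine X}
    (h : ζ.posEnd = ξ) (p : ℝ) {t : ℝ} (ht : 0 ≤ t) :
    dist ((rayTo o ξ).curve t) (ζ.1 (p + t)) ≤ dist o (ζ.1 p) := by
  have hle := GeodRay.dist_le_of_endpoint_eq_posEnd ((endpoint_rayTo o ξ).trans h.symm) p ht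
  rwa [rayTo_zero] at hle

variable {B : ℝ} {x o : X}

theorem GeodLine.IsContracting.exists_le_projParam_of_dist_rayTo_le (hB : 0 ≤ B)
    {γ ζ : GeodLine X} (h : γ.IsContracting B) {ξ η : VisualBoundary X} (hγ : γ.posEnd = ξ)
    (hζ : ζ.posEnd = η) {R : ℝ} (hR : 3 * dist o (γ.1 0) + 12 * B + 3 ≤ R)
    (hclose : dist ((rayTo o ξ).curve R) ((rayTo o η).curve R) ≤ 1) :
    ∃ u, 0 ≤ u ∧ R - 13 * B - 2 - 3 * dist o (γ.1 0) ≤ γ.projParam (ζ.1 u) := by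
  have hR₀ : 0 ≤ R := by linarith [dist_nonneg (x := o) (y := γ.1 0)]
  have hγR := GeodLine.dist_curve_rayTo_le (o := o) hγ 0 hR₀
  rw [zero_add] at hγR
  refine h.exists_le_projParam hB (ρ := rayTo o η) (by rw [rayTo_zero]) ?_ hR
    ((endpoint_rayTo o η).trans hζ.symm)
  linarith [dist_triangle_left ((rayTo o η).curve R) (γ.1 R) ((rayTo o ξ).curve R)]

theorem exists_le_tau_of_dist_rayTo_le (hB : 0 ≤ B) (x o : X) (α : ContractingPairs X B) (T : ℝ) :
    ∃ R, ∀ β : ContractingPairs X B,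
      dist ((rayTo o α.1.1).curve R) ((rayTo o β.1.1).curve R) ≤ 1 →
      dist ((rayTo o α.1.2).curve R) ((rayTo o β.1.2).curve R) ≤ 1 →
      ENNReal.ofReal T ≤ tau B x α.1 β.1 := by
  obtain ⟨γ, hγ⟩ := α.2
  have hN : 0 ≤ dist x (γ.1 0) := dist_nonneg
  obtain ⟨R, hR⟩ : ∃ R, R = |T| + 437 * B + 150 + 5 * dist x (γ.1 0) + 3 * dist o (γ.1 0) :=
    ⟨_, rfl⟩
  have hT := abs_nonneg T
  have hMR : 3 * dist o (γ.1 0) + 12 * B + 3 ≤ R := by linarith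
  refine ⟨R, fun β hneg hpos => ?_⟩
  obtain ⟨ζ, hζ⟩ := β.2
  have hrev : γ.reverse.1 0 = γ.1 0 := by rw [γ.reverse_apply, neg_zero]
  obtain ⟨u₁, hu₁, hproj₁⟩ := hγ.1.exists_le_projParam_of_dist_rayTo_le hB hγ.2.2 hζ.2.2 hMR hpos
  obtain ⟨u₀, hu₀, hproj₀⟩ := hγ.1.reverse.exists_le_projParam_of_dist_rayTo_le hB hγ.2.1 hζ.2.1
    (hrev ▸ hMR) hneg
  rw [hrev, γ.projParam_reverse, ζ.reverse_apply] at hproj₀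
  have hfellow := hγ.1.fellow_of_projParam_le hB (ζ := ζ) (u₀ := -u₀) (u₁ := u₁)
    (S := R - 13 * B - 2 - 3 * dist o (γ.1 0)) (by linarith) (by linarith) (by linarith) hproj₁ x
  refine le_trans (ENNReal.ofReal_le_ofReal ?_) (hfellow.symm.le_tau hB hγ hζ (by positivity))
  linarith [le_abs_self T]

theorem Fellow.dist_curve_rayTo_le {ζ₁ ζ₂ : GeodLine X} {K T : ℝ} (h : Fellow K T x ζ₁ ζ₂)
    (hT : 0 ≤ T) (o : X) :
    dist ((rayTo o ζ₁.posEnd).curve T) ((rayTo o ζ₂.posEnd).curve T) ≤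
      2 * (dist o (ζ₁.1 (ζ₁.projParam x)) + K) := by
  have hzero := h 0 (abs_zero.trans_le hT)
  have hend := h T (abs_of_nonneg hT).le
  rw [add_zero, add_zero] at hzero
  have h₁ := GeodLine.dist_curve_rayTo_le (o := o) (ζ := ζ₁) rfl (ζ₁.projParam x) hT
  have h₂ := GeodLine.dist_curve_rayTo_le (o := o) (ζ := ζ₂) rfl (ζ₂.projParam x) hT
  have hsplit := dist_triangle4 ((rayTo o ζ₁.posEnd).curve T) (ζ₁.1 (ζ₁.projParam x + T))
    (ζ₂.1 (ζ₂.projParam x + T)) ((rayTo o ζ₂.posEnd).curve T)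
  rw [dist_comm (ζ₂.1 _) ((rayTo o ζ₂.posEnd).curve T)] at hsplit
  linarith [dist_triangle o (ζ₁.1 (ζ₁.projParam x)) (ζ₂.1 (ζ₂.projParam x))]

theorem exists_dist_rayTo_snd_lt_of_le_tau (hB : 0 ≤ B) (x o : X) (α : ContractingPairs X B)
    {R ε : ℝ} (hR : 0 < R) (hε : 0 < ε) : ∃ T, ∀ β : ContractingPairs X B,
      ENNReal.ofReal T ≤ tau B x α.1 β.1 →
      dist ((rayTo o α.1.2).curve R) ((rayTo o β.1.2).curve R) < ε := by
  obtain ⟨γ, hγ⟩ := α.2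
  obtain ⟨D, hD⟩ : ∃ D, D = 2 * (dist o (γ.1 (γ.projParam x)) + (37 * B + 13)) := ⟨_, rfl⟩
  have hD₀ : 0 ≤ R * D / ε := by rw [hD]; positivity
  refine ⟨18 * B + 7 + R + R * D / ε, fun β h => ?_⟩
  obtain ⟨ζ, hζ⟩ := β.2
  have hT : 0 < 18 * B + 7 + R + R * D / ε := by positivity
  have hfar := (fellow_of_le_tau hB hγ hζ (by linarith) h).dist_curve_rayTo_le hT.le o
  rw [hγ.2.2, hζ.2.2, ← hD] at hfar
  have hconv := GeodRay.mul_dist_le_mul_dist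
    ((rayTo_zero o α.1.2).trans (rayTo_zero o β.1.2).symm) hR.le hT (by linarith)
  have hlt : R * D < (18 * B + 7 + R + R * D / ε) * ε := by
    rw [← div_lt_iff₀ hε]
    linarith
  exact lt_of_mul_lt_mul_left
    (hconv.trans_lt ((mul_le_mul_of_nonneg_left hfar hR.le).trans_lt hlt)) hT.le

theorem exists_dist_rayTo_lt_of_le_tau (hB : 0 ≤ B) (x o : X) (α : ContractingPairs X B)
    {R ε : ℝ} (hR : 0 < R) (hε : 0 < ε) : ∃ T, ∀ β : ContractingPairs X B,
      ENNReal.ofReal T ≤ tau B x α.1 β.1 →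
      dist ((rayTo o α.1.1).curve R) ((rayTo o β.1.1).curve R) < ε ∧
      dist ((rayTo o α.1.2).curve R) ((rayTo o β.1.2).curve R) < ε := by
  obtain ⟨T, hT⟩ := exists_dist_rayTo_snd_lt_of_le_tau hB x o α hR hε
  obtain ⟨T', hT'⟩ :=
    exists_dist_rayTo_snd_lt_of_le_tau hB x o (ContractingPairs.flip α) hR hε
  refine ⟨max T T', fun β h => ⟨?_, ?_⟩⟩
  · exact hT' (ContractingPairs.flip β) (((ENNReal.ofReal_le_ofReal (le_max_right _ _)).trans
      h).trans_eq (tau_swap B x _ _).symm)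
  · exact hT β ((ENNReal.ofReal_le_ofReal (le_max_left _ _)).trans h)

end

section

variable {X : Type u} [MetricSpace X]

/-! ### Limits of contracting lines -/

section Limit

variable {ι : Type*} {F : Ultrafilter ι} {ζ : ι → GeodLine X} {x : X} {γ : GeodLine X}

theorem exists_geodLine_tendsto [ProperSpace X] {o : X} {R : ℝ}
    (h : ∀ᶠ i in F, dist ((ζ i).1 ((ζ i).projParam x)) o ≤ R) :
    ∃ γ : GeodLine X, ∀ t, Tendsto (fun i => (ζ i).1 ((ζ i).projParam x + t)) F (𝓝 (γ.1 t)) := by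
  obtain ⟨f, hiso, hf⟩ := exists_isometry_tendsto (F := F) (E := ℝ) (e := 0) (o := o) (R := R)
    (f := fun i t => (ζ i).1 ((ζ i).projParam x + t))
    (fun s t => Eventually.of_forall fun i =>
      (ζ i).isGeodesicOn_const_add _ univ s trivial t trivial)
    (by simpa only [add_zero] using h)
  exact ⟨⟨f, hiso⟩, hf⟩

variable [IsCAT0 X]

-- A limit point of the parameters of the projections is the parameter of a nearest point of `γ`.
theorem tendsto_projParam_sub_projParam
    (h : ∀ t, Tendsto (fun i => (ζ i).1 ((ζ i).projParam x + t)) F (𝓝 (γ.1 t))) (y : X) :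
    Tendsto (fun i => (ζ i).projParam y - (ζ i).projParam x) F (𝓝 (γ.projParam y)) ∧
      Tendsto (fun i => Metric.infDist y (range (ζ i).1)) F (𝓝 (Metric.infDist y (range γ.1))) := by
  obtain ⟨q, hq⟩ := exists_tendsto_nhds_of_eventually_dist_le (F := F) (o := (0 : ℝ))
    (R := dist y x) (f := fun i => (ζ i).projParam y - (ζ i).projParam x)
    (Eventually.of_forall fun i => by
      rw [Real.dist_eq, sub_zero]
      exact (ζ i).abs_projParam_sub_projParam_le y x)
  have hlim : Tendsto (fun i => (ζ i).1 ((ζ i).projParam y)) F (𝓝 (γ.1 q)) := by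
    rw [tendsto_iff_dist_tendsto_zero] at hq ⊢
    have hsum := hq.add (tendsto_iff_dist_tendsto_zero.1 (h q))
    rw [add_zero] at hsum
    refine squeeze_zero (fun _ => dist_nonneg) (fun i => ?_) hsum
    refine (dist_triangle _ ((ζ i).1 ((ζ i).projParam x + q)) _).trans_eq ?_
    rw [(ζ i).dist_eq, Real.dist_eq, sub_add_eq_sub_sub]
  have hmin : γ.projParam y = q := γ.projParam_eq_of_forall_dist_le fun u =>
    le_of_tendsto_of_tendsto' (tendsto_const_nhds.dist hlim) (tendsto_const_nhds.dist (h u))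
      fun i => (ζ i).dist_projParam_le y _
  refine ⟨hmin ▸ hq, ?_⟩
  simp only [GeodLine.infDist_range_eq, hmin]
  exact tendsto_const_nhds.dist hlim

theorem isContracting_of_tendsto {B : ℝ} (hB : 0 ≤ B) (hζ : ∀ i, (ζ i).IsContracting B)
    (h : ∀ t, Tendsto (fun i => (ζ i).1 ((ζ i).projParam x + t)) F (𝓝 (γ.1 t))) :
    γ.IsContracting B := by
  intro p r hdisj
  have hr : r < Metric.infDist p (range γ.1) := by
    rw [γ.infDist_range_eq, ← not_le]
    exact fun hle => Set.disjoint_left.1 hdisj (Metric.mem_closedBall'.2 hle) (mem_range_self _)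
  refine Metric.ediam_le fun a ha b hb => ?_
  simp only [mem_iUnion, exists_prop] at ha hb
  obtain ⟨y, hy, ⟨s, rfl⟩, hs⟩ := ha
  obtain ⟨z, hz, ⟨t, rfl⟩, ht⟩ := hb
  rw [edist_dist, ENNReal.ofReal_le_ofReal_iff hB, γ.dist_eq,
    ← γ.projParam_eq_of_forall_dist_le fun u => hs _ (mem_range_self u),
    ← γ.projParam_eq_of_forall_dist_le fun u => ht _ (mem_range_self u)]
  refine le_of_tendsto ((tendsto_projParam_sub_projParam h y).1.sub
    (tendsto_projParam_sub_projParam h z).1).abs ?_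
  filter_upwards [(tendsto_projParam_sub_projParam h p).2.eventually_const_lt hr] with i hi
  rw [sub_sub_sub_cancel_right]
  exact (hζ i).abs_projParam_sub_le_of_lt_infDist hB hi hy hz

theorem fellow_of_dist_le {K T : ℝ} {ζ ζ' : GeodLine X}
    (hneg : dist (ζ.1 (ζ.projParam x + -T)) (ζ'.1 (ζ'.projParam x + -T)) ≤ K)
    (hpos : dist (ζ.1 (ζ.projParam x + T)) (ζ'.1 (ζ'.projParam x + T)) ≤ K) :
    Fellow K T x ζ ζ' := fun _ ht =>
  ((ζ.isGeodesicOn_const_add (ζ.projParam x) univ).convexOn_dist convex_univ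
    (ζ'.isGeodesicOn_const_add (ζ'.projParam x) univ)).le_max_of_mem_Icc (mem_univ (-T))
      (mem_univ T) (abs_le.1 ht) |>.trans (max_le hneg hpos)

theorem eventually_fellow_of_tendsto
    (h : ∀ t, Tendsto (fun i => (ζ i).1 ((ζ i).projParam x + t)) F (𝓝 (γ.1 t))) {K : ℝ}
    (hK : 0 < K) (T : ℝ) : ∀ᶠ i in F, Fellow K T x γ (ζ i) := by
  have hx : γ.projParam x = 0 := by
    have hlim := (tendsto_projParam_sub_projParam h x).1
    simp only [sub_self] at hlim
    exact tendsto_nhds_unique hlim tendsto_const_nhds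
  have hclose (t : ℝ) :
      ∀ᶠ i in F, dist (γ.1 (γ.projParam x + t)) ((ζ i).1 ((ζ i).projParam x + t)) ≤ K := by
    rw [hx, zero_add]
    simpa only [dist_comm] using (tendsto_iff_dist_tendsto_zero.1 (h t)).eventually_le_const hK
  filter_upwards [hclose (-T), hclose T] with i hneg hpos using fellow_of_dist_le hneg hpos

end Limit

theorem exists_eventually_le_tau [ProperSpace X] [IsCAT0 X] {B : ℝ} (hB : 0 ≤ B) {x : X}
    {α : ContractingPairs X B} (F : Ultrafilter (ContractingPairs X B)) {T : ℝ}
    (hT : 18 * B + 6 < T)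
    (hF : ∀ᶠ β : ContractingPairs X B in F, ENNReal.ofReal T ≤ tau B x α.1 β.1) :
    ∃ η : ContractingPairs X B, ∀ T' : ℝ, ∀ᶠ β : ContractingPairs X B in F,
      ENNReal.ofReal T' ≤ tau B x η.1 β.1 := by
  obtain ⟨ζ₀, h₀⟩ := α.2
  choose ζ hζ using fun β : ContractingPairs X B => β.2
  obtain ⟨γ, hγ⟩ := exists_geodLine_tendsto (F := F) (ζ := ζ) (x := x)
    (o := ζ₀.1 (ζ₀.projParam x)) (R := 37 * B + 13) (by
      filter_upwards [hF] with β hβ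
      simpa only [add_zero, dist_comm] using
        fellow_of_le_tau hB h₀ (hζ β) hT hβ 0 (by rw [abs_zero]; linarith))
  have hjoin : γ.ContractingJoins B (γ.negEnd, γ.posEnd) :=
    ⟨isContracting_of_tendsto hB (fun β => (hζ β).1) hγ, rfl, rfl⟩
  refine ⟨⟨_, γ, hjoin⟩, fun T' => ?_⟩
  filter_upwards [eventually_fellow_of_tendsto hγ one_pos (T' + (4 * 1 + 316 * B + 111))] with β hβ
  simpa only [add_sub_cancel_right] using hβ.le_tau hB hjoin (hζ β) zero_le_one

end

/-! ### Metrics from quasi-ultrametrics -/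

section

open PseudoMetricSpace (ofPreNNDist dist_ofPreNNDist)

variable {A A' : Type*} {d : A → A → ℝ≥0} {d' : A' → A' → ℝ≥0}

/-- The length of the chain of points `L` with respect to `d`, that is, the sum of `d` over the
consecutive pairs of `L`. The distances of `PseudoMetricSpace.ofPreNNDist` are infima of lengths of
chains. -/
def chainLength (d : A → A → ℝ≥0) : List A → ℝ≥0
  | x :: y :: L => d x y + chainLength d (y :: L)
  | _ => 0

theorem chainLength_cons_append_singleton (d : A → A → ℝ≥0) (x : A) (L : List A) (y : A) :
    chainLength d (x :: (L ++ [y])) = ((x :: L).zipWith d (L ++ [y])).sum := by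
  induction L generalizing x with
  | nil => simp [chainLength]
  | cons z L ih => simp [chainLength, ih]

theorem chainLength_map {f : A → A'} (hf : ∀ x y, d' (f x) (f y) = d x y) (L : List A) :
    chainLength d' (L.map f) = chainLength d L := by
  induction L with
  | nil => rfl
  | cons x L ih =>
    cases L with
    | nil => rfl
    | cons y L => exact congrArg₂ (· + ·) (hf x y) ih

theorem le_chainLength (L₁ : List A) (z z' : A) (L₂ : List A) :
    d z z' ≤ chainLength d (L₁ ++ z :: z' :: L₂) := by
  induction L₁ with
  | nil => exact le_self_add
  | cons x L₁ ih =>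
    cases L₁ with
    | nil => exact ih.trans le_add_self
    | cons y L₁ => exact ih.trans le_add_self

theorem exists_link_of_chainLength_le {x y : A} {L : List A} {a b : ℝ≥0}
    (h : chainLength d (x :: y :: L) ≤ a + b) :
    ∃ L₁ z z' L₂, x :: y :: L = L₁ ++ z :: z' :: L₂ ∧
      chainLength d (L₁ ++ [z]) ≤ a ∧ chainLength d (z' :: L₂) ≤ b := by
  induction L generalizing x y a with
  | nil => exact ⟨[], x, y, [], rfl, zero_le, zero_le⟩
  | cons w L ih =>
    rw [chainLength] at h
    rcases le_total a (d x y) with hle | hge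
    · exact ⟨[], x, y, w :: L, rfl, zero_le, le_of_add_le_add_left (h.trans (by gcongr))⟩
    · obtain ⟨e, rfl⟩ := exists_add_of_le hge
      rw [add_assoc, add_le_add_iff_left] at h
      obtain ⟨L₁, z, z', L₂, hL, hleft, hright⟩ := ih h
      refine ⟨x :: L₁, z, z', L₂, by rw [hL, List.cons_append], ?_, hright⟩
      cases L₁ with
      | nil =>
        obtain rfl : y = z := (List.cons.inj hL).1
        exact (add_zero (d x y)).trans_le le_self_add
      | cons u L₁ =>
        obtain rfl : y = u := (List.cons.inj hL).1
        exact add_le_add_right hleft _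

theorem mul_le_of_le_mul_max {c s p q r t w : ℝ} (hc : 0 ≤ c) (hc2 : (1 + c) ^ 2 ≤ 2)
    (hp : p ≤ (1 + c) * max q w) (hw : w ≤ (1 + c) * max r t) (hq : (1 - 2 * c) * q ≤ s / 2)
    (hr₀ : 0 ≤ r) (hr : r ≤ s) (ht : (1 - 2 * c) * t ≤ s / 2) : (1 - 2 * c) * p ≤ s := by
  have hk : 0 ≤ 1 - 2 * c := by nlinarith
  have hk2 : (1 - 2 * c) * (1 + c) ^ 2 ≤ 1 := by nlinarith [pow_nonneg hc 3]
  have hmiddle : (1 + c) * ((1 - 2 * c) * w) ≤ s := by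
    have hw' := mul_le_mul_of_nonneg_left hw (mul_nonneg (by linarith : 0 ≤ 1 + c) hk)
    rcases max_cases r t with ⟨hmax, -⟩ | ⟨hmax, -⟩ <;> rw [hmax] at hw'
    · nlinarith
    · nlinarith
  have hp' := mul_le_mul_of_nonneg_left hp hk
  rcases max_cases q w with ⟨hmax, -⟩ | ⟨hmax, -⟩ <;> rw [hmax] at hp'
  · nlinarith
  · linarith

-- The chain is cut at a link which leaves at most half of its length on either side.
theorem mul_le_chainLength (hself : ∀ x, d x x = 0) {c : ℝ} (hc : 0 ≤ c) (hc2 : (1 + c) ^ 2 ≤ 2)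
    (hd : ∀ x y z, (d x z : ℝ) ≤ (1 + c) * max (d x y) (d y z)) (L : List A) :
    ∀ x ∈ L.head?, ∀ y ∈ L.getLast?, (1 - 2 * c) * d x y ≤ chainLength d L := by
  intro x hx y hy
  match L with
  | [] => simp at hx
  | [w] =>
    obtain rfl : w = x := by simpa using hx
    obtain rfl : w = y := by simpa using hy
    rw [hself, NNReal.coe_zero, mul_zero]
    exact NNReal.coe_nonneg _
  | u :: v :: L =>
    set s := chainLength d (u :: v :: L) with hs
    obtain ⟨L₁, z, z', L₂, hL, hleft, hright⟩ :=
      exists_link_of_chainLength_le (d := d) (add_halves s).ge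
    have hlink : (d z z' : ℝ) ≤ s := by
      rw [hs, hL]
      exact le_chainLength L₁ z z' L₂
    have hlen : (u :: v :: L).length = L₁.length + L₂.length + 2 := by
      simp only [hL, List.length_append, List.length_cons]
      omega
    rw [hL] at hx hy
    have hxz := mul_le_chainLength hself hc hc2 hd (L₁ ++ [z]) x (by simpa using hx) z (by simp)
    have hzy := mul_le_chainLength hself hc hc2 hd (z' :: L₂) z' (by simp) y (by simpa using hy)
    have hhalf : ((s / 2 : ℝ≥0) : ℝ) = s / 2 := by push_cast; rfl
    replace hxz := hxz.trans ((NNReal.coe_le_coe.2 hleft).trans_eq hhalf)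
    replace hzy := hzy.trans ((NNReal.coe_le_coe.2 hright).trans_eq hhalf)
    exact mul_le_of_le_mul_max hc hc2 (hd x z y) (hd z z' y) hxz (NNReal.coe_nonneg _)
      hlink hzy
termination_by L.length
decreasing_by
  all_goals
    simp only [List.length_append, List.length_cons, List.length_nil] at hlen ⊢
    omega

section ofPreNNDist

variable (hself : ∀ x, d x x = 0) (hcomm : ∀ x y, d x y = d y x)

theorem dist_ofPreNNDist_eq_iInf_chainLength (x y : A) :
    (ofPreNNDist d hself hcomm).dist x y = ↑(⨅ L : List A, chainLength d (x :: (L ++ [y]))) := by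
  simp only [chainLength_cons_append_singleton]
  exact dist_ofPreNNDist d hself hcomm x y

theorem le_mul_dist_ofPreNNDist {m : A → A → ℝ} (htri : ∀ x y z, m x z ≤ m x y + m y z) (C : ℝ≥0)
    (hm : ∀ x y, m x y ≤ C * d x y) (x y : A) :
    m x y ≤ C * (ofPreNNDist d hself hcomm).dist x y := by
  have hchain (L : List A) (x : A) : m x y ≤ C * chainLength d (x :: (L ++ [y])) := by
    induction L generalizing x with
    | nil => simpa [chainLength] using hm x y
    | cons z L ih =>
      refine (htri x z y).trans ((add_le_add (hm x z) (ih z)).trans_eq ?_)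
      simp only [List.cons_append, chainLength, NNReal.coe_add, mul_add]
  rw [dist_ofPreNNDist_eq_iInf_chainLength, ← NNReal.coe_mul, NNReal.mul_iInf, NNReal.coe_iInf]
  exact le_ciInf fun L => hchain L x

theorem mul_le_dist_ofPreNNDist {c : ℝ} (hc : 0 ≤ c) (hc2 : (1 + c) ^ 2 ≤ 2)
    (hd : ∀ x y z, (d x z : ℝ) ≤ (1 + c) * max (d x y) (d y z)) (x y : A) :
    (1 - 2 * c) * d x y ≤ (ofPreNNDist d hself hcomm).dist x y := by
  rw [dist_ofPreNNDist_eq_iInf_chainLength, NNReal.coe_iInf]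
  exact le_ciInf fun L => mul_le_chainLength hself hc hc2 hd _ x rfl y
    (by rw [← List.cons_append, List.getLast?_concat]; rfl)

theorem dist_ofPreNNDist_map (hself' : ∀ x, d' x x = 0) (hcomm' : ∀ x y, d' x y = d' y x)
    {f : A → A'} (hf : ∀ x y, d' (f x) (f y) = d x y) (hsurj : f.Surjective) (x y : A) :
    (ofPreNNDist d' hself' hcomm').dist (f x) (f y) = (ofPreNNDist d hself hcomm).dist x y := by
  simp only [dist_ofPreNNDist_eq_iInf_chainLength]
  refine congrArg _ ((List.map_surjective_iff.2 hsurj).iInf_congr _ fun L => ?_).symm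
  rw [← chainLength_map hf, List.map_cons, List.map_append, List.map_singleton]

end ofPreNNDist

end

section

variable {X : Type u} [MetricSpace X] {B χ : ℝ}

/-! ### The quasi-ultrametric `δ̃_x` -/

theorem deltaTilde_self (B χ : ℝ) (x : X) (α : ContractingPairs X B) :
    deltaTilde B χ x α α = 0 :=
  if_pos rfl

theorem deltaTilde_of_ne {x : X} {α β : ContractingPairs X B} (h : α ≠ β) :
    deltaTilde B χ x α β = Real.exp (-χ * (tau B x α.1 β.1).toReal) :=
  if_neg h

theorem deltaTilde_pos_of_ne {x : X} {α β : ContractingPairs X B} (h : α ≠ β) :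
    0 < deltaTilde B χ x α β :=
  deltaTilde_of_ne h ▸ Real.exp_pos _

theorem deltaTilde_nonneg (B χ : ℝ) (x : X) (α β : ContractingPairs X B) :
    0 ≤ deltaTilde B χ x α β := by
  by_cases h : α = β
  · rw [h, deltaTilde_self]
  · exact (deltaTilde_pos_of_ne h).le

variable [IsCAT0 X]

theorem deltaTilde_comm (B χ : ℝ) (x : X) (α β : ContractingPairs X B) :
    deltaTilde B χ x α β = deltaTilde B χ x β α := by
  by_cases h : α = β
  · rw [h]
  · rw [deltaTilde_of_ne h, deltaTilde_of_ne (Ne.symm h), tau_comm]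

theorem deltaTilde_flip (B χ : ℝ) (x : X) (α β : ContractingPairs X B) :
    deltaTilde B χ x (ContractingPairs.flip α) (ContractingPairs.flip β) =
      deltaTilde B χ x α β := by
  by_cases h : α = β
  · rw [h, deltaTilde_self, deltaTilde_self]
  · rw [deltaTilde_of_ne h, deltaTilde_of_ne (ContractingPairs.flip_involutive.injective.ne h)]
    exact congrArg (fun t => Real.exp (-χ * ENNReal.toReal t)) (tau_swap B x _ _)

theorem deltaTilde_map (B χ : ℝ) (g : X ≃ᵢ X) (x : X) (α β : ContractingPairs X B) :
    deltaTilde B χ (g x) (ContractingPairs.map g α) (ContractingPairs.map g β) =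
      deltaTilde B χ x α β := by
  by_cases h : α = β
  · rw [h, deltaTilde_self, deltaTilde_self]
  · rw [deltaTilde_of_ne h, deltaTilde_of_ne ((ContractingPairs.map_bijective g).injective.ne h),
      tau_map]

theorem deltaTilde_le_exp_mul (hB : 0 ≤ B) (hχ : 0 ≤ χ) (x y : X) (α β : ContractingPairs X B) :
    deltaTilde B χ y α β ≤ Real.exp (χ * dist x y) * deltaTilde B χ x α β := by
  by_cases h : α = β
  · rw [h, deltaTilde_self, deltaTilde_self, mul_zero]
  have hτ : (tau B x α.1 β.1).toReal ≤ (tau B y α.1 β.1).toReal + dist x y := by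
    rw [← ENNReal.ofReal_le_ofReal_iff (by positivity), ENNReal.ofReal_add (by simp) dist_nonneg,
      ENNReal.ofReal_toReal (tau_ne_top hB x h), ENNReal.ofReal_toReal (tau_ne_top hB y h)]
    exact tau_le_add_dist B x y α.1 β.1
  rw [deltaTilde_of_ne h, deltaTilde_of_ne h, ← Real.exp_add, Real.exp_le_exp]
  linarith [mul_le_mul_of_nonneg_left hτ hχ]

theorem deltaTilde_le_exp_iff (hB : 0 ≤ B) (hχ : 0 < χ) (x : X) (α β : ContractingPairs X B)
    (T : ℝ) : deltaTilde B χ x α β ≤ Real.exp (-χ * T) ↔ ENNReal.ofReal T ≤ tau B x α.1 β.1 := by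
  by_cases h : α = β
  · refine iff_of_true ?_ ?_
    · rw [h, deltaTilde_self]
      exact (Real.exp_pos _).le
    · obtain ⟨ζ, hζ⟩ := α.2
      have hfellow : Fellow 0 (T + (4 * 0 + 316 * B + 111)) x ζ ζ := fun t _ => (dist_self _).le
      simpa only [add_sub_cancel_right, ← h] using hfellow.le_tau hB hζ hζ le_rfl
  · rw [deltaTilde_of_ne h, Real.exp_le_exp, ENNReal.ofReal_le_iff_le_toReal (tau_ne_top hB x h),
      neg_mul, neg_mul, neg_le_neg_iff, mul_le_mul_iff_right₀ hχ]

theorem exists_exp_neg_mul_eq (hχ : χ ≠ 0) {m : ℝ} (hm : 0 < m) : ∃ T, Real.exp (-χ * T) = m :=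
  ⟨-Real.log m / χ, by rw [neg_mul, mul_div_cancel₀ _ hχ, neg_neg, Real.exp_log hm]⟩

theorem deltaTilde_le_mul_max (hB : 0 ≤ B) (hχ : 0 < χ) (x : X) (α β η : ContractingPairs X B) :
    deltaTilde B χ x α η ≤ Real.exp (χ * (612 * (B + 1))) *
      max (deltaTilde B χ x α β) (deltaTilde B χ x β η) := by
  by_cases h : α = β ∧ β = η
  · obtain ⟨rfl, rfl⟩ := h
    rw [deltaTilde_self, max_self, mul_zero]
  have hm : 0 < max (deltaTilde B χ x α β) (deltaTilde B χ x β η) := by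
    rcases not_and_or.1 h with hne | hne
    · exact lt_max_of_lt_left (deltaTilde_pos_of_ne hne)
    · exact lt_max_of_lt_right (deltaTilde_pos_of_ne hne)
  obtain ⟨T, hT⟩ := exists_exp_neg_mul_eq hχ.ne' hm
  obtain ⟨hαβ, hβη⟩ := max_le_iff.1 hT.ge
  rw [deltaTilde_le_exp_iff hB hχ] at hαβ hβη
  rw [← hT, ← Real.exp_add,
    show χ * (612 * (B + 1)) + -χ * T = -χ * (T - 612 * (B + 1)) by ring,
    deltaTilde_le_exp_iff hB hχ]
  exact le_tau_of_le_tau hB hαβ hβη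

/-! ### The topology of a metric comparable to `δ̃_x` -/

theorem induced_prod_coneTopology [ProperSpace X] (o : X) :
    TopologicalSpace.induced (Subtype.val : ContractingPairs X B → _)
        (@instTopologicalSpaceProd _ _ (coneTopology o) (coneTopology o)) =
      TopologicalSpace.induced (fun α : ContractingPairs X B => rayTo o α.1.1) inferInstance ⊓
        TopologicalSpace.induced (fun α : ContractingPairs X B => rayTo o α.1.2) inferInstance := by
  rw [coneTopology_eq_induced]
  unfold instTopologicalSpaceProd
  rw [induced_inf]
  iterate 4 rw [induced_compose (tγ := _)]
  rfl

section Topology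

variable {k : ℝ} [PseudoMetricSpace (ContractingPairs X B)] {x : X}

theorem hasBasis_nhds_tau (hB : 0 ≤ B) (hχ : 0 < χ) (hk : 0 < k)
    (h : ∀ α β : ContractingPairs X B, k * deltaTilde B χ x α β ≤ dist α β ∧
      dist α β ≤ deltaTilde B χ x α β) (α : ContractingPairs X B) :
    (𝓝 α).HasBasis (fun _ : ℝ => True) fun T => {β | ENNReal.ofReal T ≤ tau B x α.1 β.1} := by
  simp only [← deltaTilde_le_exp_iff hB hχ]
  refine Metric.nhds_basis_ball.to_hasBasis (fun ε hε => ?_) fun T _ => ?_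
  · obtain ⟨T, hT⟩ := exists_exp_neg_mul_eq hχ.ne' (half_pos hε)
    refine ⟨T, trivial, fun β hβ => ?_⟩
    rw [Metric.mem_ball, dist_comm]
    exact (h α β).2.trans_lt ((hβ.trans_eq hT).trans_lt (half_lt_self hε))
  · refine ⟨k * Real.exp (-χ * T), by positivity, fun β hβ => ?_⟩
    rw [Metric.mem_ball, dist_comm] at hβ
    exact (lt_of_mul_lt_mul_left ((h α β).1.trans_lt hβ) hk.le).le

variable [ProperSpace X]

theorem toTopologicalSpace_eq_induced (hB : 0 ≤ B) (hχ : 0 < χ) (hk : 0 < k)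
    (h : ∀ α β : ContractingPairs X B, k * deltaTilde B χ x α β ≤ dist α β ∧
      dist α β ≤ deltaTilde B χ x α β) (o : X) :
    (inferInstance : TopologicalSpace (ContractingPairs X B)) =
      TopologicalSpace.induced Subtype.val
        (@instTopologicalSpaceProd _ _ (coneTopology o) (coneTopology o)) := by
  rw [induced_prod_coneTopology]
  refine TopologicalSpace.ext_nhds fun α => ?_
  refine Eq.trans ?_ (nhds_inf.trans
    (congrArg₂ _ (nhds_induced _ _) (nhds_induced _ _))).symm
  have hbasis := hasBasis_nhds_tau hB hχ hk h α
  have hfst : Tendsto (fun β : ContractingPairs X B => rayTo o β.1.1) (𝓝 α) (𝓝 (rayTo o α.1.1)) :=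
    GeodRay.tendsto_nhds_of_forall_dist_lt (by simp only [rayTo_zero, implies_true])
      fun R hR ε hε => by
        obtain ⟨T, hT⟩ := exists_dist_rayTo_lt_of_le_tau hB x o α hR hε
        exact hbasis.eventually_iff.2 ⟨T, trivial, fun β hβ => (hT β hβ).1⟩
  have hsnd : Tendsto (fun β : ContractingPairs X B => rayTo o β.1.2) (𝓝 α) (𝓝 (rayTo o α.1.2)) :=
    GeodRay.tendsto_nhds_of_forall_dist_lt (by simp only [rayTo_zero, implies_true])
      fun R hR ε hε => by
        obtain ⟨T, hT⟩ := exists_dist_rayTo_lt_of_le_tau hB x o α hR hε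
        exact hbasis.eventually_iff.2 ⟨T, trivial, fun β hβ => (hT β hβ).2⟩
  refine le_antisymm (le_inf (tendsto_iff_comap.1 hfst) (tendsto_iff_comap.1 hsnd)) ?_
  refine hbasis.ge_iff.2 fun T _ => ?_
  obtain ⟨R, hR⟩ := exists_le_tau_of_dist_rayTo_le hB x o α T
  refine mem_of_superset (inter_mem_inf
    (preimage_mem_comap (GeodRay.setOf_dist_curve_lt_mem_nhds (rayTo o α.1.1) R zero_lt_one))
    (preimage_mem_comap (GeodRay.setOf_dist_curve_lt_mem_nhds (rayTo o α.1.2) R zero_lt_one))) ?_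
  exact fun β hβ => hR β hβ.1.le hβ.2.le

-- A closed ball on which `τ_B` is large is compact: by `exists_eventually_le_tau` every ultrafilter
-- on it converges.
theorem locallyCompactSpace_contractingPairs (hB : 0 ≤ B) (hχ : 0 < χ) (hk : 0 < k)
    (h : ∀ α β : ContractingPairs X B, k * deltaTilde B χ x α β ≤ dist α β ∧
      dist α β ≤ deltaTilde B χ x α β) : LocallyCompactSpace (ContractingPairs X B) := by
  suffices WeaklyLocallyCompactSpace (ContractingPairs X B) by infer_instance
  refine ⟨fun α => ?_⟩
  obtain ⟨ε, hε, hball⟩ := Metric.nhds_basis_closedBall.mem_iff.1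
    ((hasBasis_nhds_tau hB hχ hk h α).mem_of_mem (i := 18 * B + 7) trivial)
  refine ⟨Metric.closedBall α ε, ?_, Metric.closedBall_mem_nhds α hε⟩
  rw [isCompact_iff_ultrafilter_le_nhds]
  intro F hF
  rw [le_principal_iff] at hF
  obtain ⟨η, hη⟩ := exists_eventually_le_tau hB F (T := 18 * B + 7) (by linarith)
    (mem_of_superset hF hball)
  have hle : (F : Filter (ContractingPairs X B)) ≤ 𝓝 η :=
    (hasBasis_nhds_tau hB hχ hk h η).ge_iff.2 fun T _ => hη T
  exact ⟨η, isClosed_iff_ultrafilter.1 Metric.isClosed_closedBall η F hle hF, hle⟩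

end Topology

/-! ### The metric `δ_x` -/

/-- `δ̃_x` as a function with values in `ℝ≥0`. -/
noncomputable def nnDeltaTilde (B χ : ℝ) (x : X) (α β : ContractingPairs X B) : ℝ≥0 :=
  ⟨deltaTilde B χ x α β, deltaTilde_nonneg B χ x α β⟩

/-- The pseudometric `δ_x` on `𝒜(B)`: the largest pseudometric which is at most `δ̃_x`. -/
@[reducible]
noncomputable def deltaPseudoMetric (B χ : ℝ) (x : X) : PseudoMetricSpace (ContractingPairs X B) :=
  .ofPreNNDist (nnDeltaTilde B χ x) (fun α => NNReal.eq (deltaTilde_self B χ x α))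
    fun α β => NNReal.eq (deltaTilde_comm B χ x α β)

theorem deltaPseudoMetric_dist_le (B χ : ℝ) (x : X) (α β : ContractingPairs X B) :
    (deltaPseudoMetric B χ x).dist α β ≤ deltaTilde B χ x α β :=
  PseudoMetricSpace.dist_ofPreNNDist_le _ _ _ α β

theorem deltaPseudoMetric_dist_flip (B χ : ℝ) (x : X) (α β : ContractingPairs X B) :
    (deltaPseudoMetric B χ x).dist (ContractingPairs.flip α) (ContractingPairs.flip β) =
      (deltaPseudoMetric B χ x).dist α β :=
  dist_ofPreNNDist_map (d := nnDeltaTilde B χ x) (d' := nnDeltaTilde B χ x) _ _ _ _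
    (fun α β => NNReal.eq (deltaTilde_flip B χ x α β))
    ContractingPairs.flip_involutive.surjective α β

theorem deltaPseudoMetric_dist_map (B χ : ℝ) (g : X ≃ᵢ X) (x : X) (α β : ContractingPairs X B) :
    (deltaPseudoMetric B χ (g x)).dist (ContractingPairs.map g α) (ContractingPairs.map g β) =
      (deltaPseudoMetric B χ x).dist α β :=
  dist_ofPreNNDist_map (d := nnDeltaTilde B χ x) (d' := nnDeltaTilde B χ (g x)) _ _ _ _
    (fun α β => NNReal.eq (deltaTilde_map B χ g x α β))
    (ContractingPairs.map_bijective g).surjective α β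

theorem deltaPseudoMetric_dist_le_exp_mul (hB : 0 ≤ B) (hχ : 0 ≤ χ) (x y : X)
    (α β : ContractingPairs X B) : (deltaPseudoMetric B χ y).dist α β ≤
      Real.exp (χ * dist x y) * (deltaPseudoMetric B χ x).dist α β :=
  le_mul_dist_ofPreNNDist (d := nnDeltaTilde B χ x) _ _ (deltaPseudoMetric B χ y).dist_triangle
    ⟨Real.exp (χ * dist x y), (Real.exp_pos _).le⟩
    (fun α β => (deltaPseudoMetric_dist_le B χ y α β).trans (deltaTilde_le_exp_mul hB hχ x y α β))
    α β

theorem exp_neg_mul_le_deltaPseudoMetric_dist (hB : 0 ≤ B) (hχ : 0 ≤ χ) (x y : X)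
    (α β : ContractingPairs X B) :
    Real.exp (-χ * dist x y) * (deltaPseudoMetric B χ x).dist α β ≤
      (deltaPseudoMetric B χ y).dist α β := by
  rw [neg_mul, Real.exp_neg, inv_mul_le_iff₀ (Real.exp_pos _), dist_comm x y]
  exact deltaPseudoMetric_dist_le_exp_mul hB hχ y x α β

theorem mul_le_deltaPseudoMetric_dist (hB : 0 ≤ B) (hχ : 0 < χ) {χ' : ℝ}
    (hχ' : χ' = Real.exp (χ * (612 * (B + 1))) - 1) (hlt : χ' < Real.sqrt 2 - 1) (x : X)
    (α β : ContractingPairs X B) :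
    (1 - 2 * χ') * deltaTilde B χ x α β ≤ (deltaPseudoMetric B χ x).dist α β := by
  have hnonneg : 0 ≤ χ' := by
    rw [hχ', sub_nonneg]
    exact Real.one_le_exp (by positivity)
  have hsq : (1 + χ') ^ 2 ≤ 2 :=
    (Real.le_sqrt (by linarith) zero_le_two).1 (by linarith)
  refine mul_le_dist_ofPreNNDist (d := nnDeltaTilde B χ x) _ _ hnonneg hsq (fun α β η => ?_) α β
  rw [hχ', add_sub_cancel, NNReal.coe_max]
  exact deltaTilde_le_mul_max hB hχ x α β η

/-- The metric `δ_x` on `𝒜(B)`. It separates points as soon as it is bounded below by a positive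
multiple of `δ̃_x`. -/
@[reducible]
noncomputable def deltaMetric (x : X) {k : ℝ} (hk : 0 < k) (h : ∀ α β : ContractingPairs X B,
    k * deltaTilde B χ x α β ≤ (deltaPseudoMetric B χ x).dist α β) :
    MetricSpace (ContractingPairs X B) where
  toPseudoMetricSpace := deltaPseudoMetric B χ x
  eq_of_dist_eq_zero {α β} hαβ := by
    by_contra hne
    exact ((mul_pos hk (deltaTilde_pos_of_ne hne)).trans_le (h α β)).ne' hαβ

end

theorem mainTheorem8 :
    ∃ L : ℝ, 0 < L ∧ ∀ B : ℝ, 0 < B → ∀ χ : ℝ, 0 < χ → ∀ χ' : ℝ,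
      χ' = Real.exp (χ * (L * (B + 1))) - 1 → χ' < Real.sqrt 2 - 1 →
      ∀ (X : Type u) [MetricSpace X] [ProperSpace X] [IsCAT0 X],
      ∃ δ : X → MetricSpace (ContractingPairs X B),
        -- the topology of `δ_x` is the restriction of the product topology
        (∀ x o : X, (δ x).toUniformSpace.toTopologicalSpace =
          TopologicalSpace.induced Subtype.val
            (@instTopologicalSpaceProd _ _ (coneTopology o) (coneTopology o))) ∧
        (∀ x : X, @LocallyCompactSpace (ContractingPairs X B)
          (δ x).toUniformSpace.toTopologicalSpace) ∧
        -- invariance under the flip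
        (∀ (x : X) (α β : ContractingPairs X B),
          (δ x).dist (ContractingPairs.flip α) (ContractingPairs.flip β) = (δ x).dist α β) ∧
        -- comparison with `δ̃_x`
        (∀ (x : X) (α β : ContractingPairs X B),
          (1 - 2 * χ') * deltaTilde B χ x α β ≤ (δ x).dist α β ∧
            (δ x).dist α β ≤ deltaTilde B χ x α β) ∧
        -- dependence on the base point
        (∀ (x y : X) (α β : ContractingPairs X B),
          Real.exp (-χ * dist x y) * (δ x).dist α β ≤ (δ y).dist α β ∧
            (δ y).dist α β ≤ Real.exp (χ * dist x y) * (δ x).dist α β) ∧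
        -- invariance under the isometry group
        (∀ (g : X ≃ᵢ X) (x : X) (α β : ContractingPairs X B),
          (δ (g x)).dist (ContractingPairs.map g α) (ContractingPairs.map g β) =
            (δ x).dist α β) := by
  refine ⟨612, by norm_num, fun B hB χ hχ χ' hχ' hlt X _ _ _ => ?_⟩
  have hk : 0 < 1 - 2 * χ' := by
    linarith [(Real.sqrt_lt' (by norm_num : (0 : ℝ) < 3 / 2)).2 (by norm_num : (2 : ℝ) < _)]
  have hlower (x : X) (α β : ContractingPairs X B) :
      (1 - 2 * χ') * deltaTilde B χ x α β ≤ (deltaPseudoMetric B χ x).dist α β :=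
    mul_le_deltaPseudoMetric_dist hB.le hχ hχ' hlt x α β
  have hcomparison (x : X) (α β : ContractingPairs X B) :=
    And.intro (hlower x α β) (deltaPseudoMetric_dist_le B χ x α β)
  refine ⟨fun x => deltaMetric x hk (hlower x), fun x o => ?_, fun x => ?_,
    deltaPseudoMetric_dist_flip B χ, hcomparison, fun x y α β =>
      ⟨exp_neg_mul_le_deltaPseudoMetric_dist hB.le hχ.le x y α β,
        deltaPseudoMetric_dist_le_exp_mul hB.le hχ.le x y α β⟩, deltaPseudoMetric_dist_map B χ⟩
  · let := deltaPseudoMetric B χ x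
    exact toTopologicalSpace_eq_induced hB.le hχ hk (hcomparison x) o
  · let := deltaPseudoMetric B χ x
    exact locallyCompactSpace_contractingPairs hB.le hχ hk (hcomparison x)
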